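/- Let $0<p\le 1$. A (real) $p$-Banach space is a real vector space $X$ with a complete $p$-norm, i.e. a map $\|\cdot\|:X\to[0,\infty)$ with $\|x\|=0$ iff $x=0$, $\|ax\|=|a|\,\|x\|$ and $\|x+y\|^p\le\|x\|^p+\|y\|^p$, for which every Cauchy sequence converges. The $\ell_p$-sum $\bigl(\bigoplus_{n} X_n\bigr)_{\ell_p}$ of $p$-Banach spaces $X_n$ is the space of families $x=(x_n)_n\in\prod_n X_n$ with $\|x\|=\bigl(\sum_n\|x_n\|^p\bigr)^{1/p}<\infty$. For a metric space $(M,d)$, the Lipschitz free $p$-space $\mathcal F_p(M)$ is the completion of the linear span of the formal differences $\delta_x-\delta_y$ ($x,y\in M$) under the $p$-norm $$\|\mu\|=\inf\Bigl\{\Bigl(\sum_{i}|a_i|^p d(x_i,y_i)^p\Bigr)^{1/p}:\ \mu=\sum_{i}a_i(\delta_{x_i}-\delta_{y_i})\ \text{a finite sum}\Bigr\}.$$ Equivalently, for any choice of a base point $0\in M$, with $\delta(x)=\delta_x-\delta_0$, it is the $p$-Banach space with an isometric embedding $\delta:M\to\mathcal F_p(M)$ such that every Lipschitz map $f$ from $M$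 to a $p$-Banach space $X$ with $f(0)=0$ has a unique bounded linear $T_f:\mathcal F_p(M)\to X$ with $T_f\circ\delta=f$, and $\|T_f\|$ is the Lipschitz constant of $f$. A metric space is proper if its closed bounded subsets are compact, and scattered if one of its Cantor--Bendixson derivatives $M^{(\alpha)}$, $\alpha$ an ordinal, is empty. **Theorem.** Let $0<p\le1$ and let $(P)$ be a property of $p$-Banach spaces such that 1. every finite-dimensional $p$-Banach space has $(P)$; 2. if $(X_n)_{n\in\mathbb N}$ is a sequence of $p$-Banach spaces with $(P)$, then $\bigl(\bigoplus_{n} X_n\bigr)_{\ell_p}$ has $(P)$; 3. if $X$ has $(P)$ and $Y$ is isomorphic to $X$ (there is a linear bijection $X\to Y$ bounded in both directions), then $Y$ has $(P)$; 4. if $X$ has $(P)$, then so does every closed subspace of $X$ that is the range of a bounded linear projection $X\to X$. Then $\mathcal F_p(M)$ has $(P)$ for every scattered proper metric space $M$. -/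

import Mathlib

open Filter Topology

universe u

/-- A real `p`-Banach space, `0 < p ≤ 1`: a real vector space with a complete `p`-norm, that is,
a map `‖·‖` that is positive definite, absolutely homogeneous, satisfies
`‖x + y‖ ^ p ≤ ‖x‖ ^ p + ‖y‖ ^ p`, and for which every Cauchy sequence converges. -/
structure PBanachSpace (p : Set.Ioc (0 : ℝ) 1) : Type (u + 1) where
  carrier : Type u
  [addCommGroup : AddCommGroup carrier]
  [module : Module ℝ carrier]
  [norm : Norm carrier]
  norm_nonneg' : ∀ x : carrier, 0 ≤ ‖x‖
  norm_eq_zero' : ∀ x : carrier, ‖x‖ = 0 ↔ x = 0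
  norm_smul' : ∀ (a : ℝ) (x : carrier), ‖a • x‖ = |a| * ‖x‖
  norm_add_rpow_le : ∀ x y : carrier, ‖x + y‖ ^ (p : ℝ) ≤ ‖x‖ ^ (p : ℝ) + ‖y‖ ^ (p : ℝ)
  exists_lim : ∀ s : ℕ → carrier,
    (∀ ε : ℝ, 0 < ε → ∃ N : ℕ, ∀ m ≥ N, ∀ n ≥ N, ‖s m - s n‖ < ε) →
    ∃ x : carrier, Tendsto (fun n => ‖s n - x‖) atTop (𝓝 0)

namespace PBanachSpace

variable {p : Set.Ioc (0 : ℝ) 1}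

instance : CoeSort (PBanachSpace.{u} p) (Type u) := ⟨carrier⟩

attribute [instance] addCommGroup module norm

/-! ### Bounded operators, isomorphisms, complemented subspaces -/

/-- A linear map between `p`-Banach spaces is bounded. -/
def IsBounded {X Y : PBanachSpace.{u} p} (T : X →ₗ[ℝ] Y) : Prop :=
  ∃ C : ℝ, ∀ x : X, ‖T x‖ ≤ C * ‖x‖

/-- Two `p`-Banach spaces are isomorphic: there is a linear bijection bounded in both
directions. -/
def Isomorphic (X Y : PBanachSpace.{u} p) : Prop :=
  ∃ T : X ≃ₗ[ℝ] Y, IsBounded (T : X →ₗ[ℝ] Y) ∧ IsBounded (T.symm : Y →ₗ[ℝ] X)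

/-- A linear subspace is (sequentially, hence topologically) closed. -/
def IsClosedSubspace (X : PBanachSpace.{u} p) (S : Submodule ℝ X) : Prop :=
  ∀ (s : ℕ → X) (x : X), (∀ n, s n ∈ S) →
    Tendsto (fun n => ‖s n - x‖) atTop (𝓝 0) → x ∈ S

/-- A closed linear subspace of a `p`-Banach space, with the restricted `p`-norm. -/
def subspace (X : PBanachSpace.{u} p) (S : Submodule ℝ X) (hS : X.IsClosedSubspace S) :
    PBanachSpace.{u} p :=
  letI : Norm S := ⟨fun x => ‖(x : X)‖⟩
  { carrier := S
    norm_nonneg' := fun x => X.norm_nonneg' x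
    norm_eq_zero' := fun x => (X.norm_eq_zero' x).trans Submodule.coe_eq_zero
    norm_smul' := fun a x => X.norm_smul' a x
    norm_add_rpow_le := fun x y => X.norm_add_rpow_le x y
    exists_lim := fun s hs => by
      obtain ⟨x, hx⟩ := X.exists_lim (fun n => (s n : X)) hs
      exact ⟨⟨x, hS _ x (fun n => (s n).2) hx⟩, hx⟩ }

/-- A linear subspace is complemented: it is the range of a bounded linear projection. -/
def IsComplemented (X : PBanachSpace.{u} p) (S : Submodule ℝ X) : Prop :=
  ∃ π : X →ₗ[ℝ] X, IsBounded π ∧ (∀ x, π x ∈ S) ∧ ∀ x ∈ S, π x = x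

/-! ### The metric `‖x - y‖ ^ p` of a `p`-Banach space -/

theorem p_pos (p : Set.Ioc (0 : ℝ) 1) : 0 < (p : ℝ) := p.2.1

theorem p_le_one (p : Set.Ioc (0 : ℝ) 1) : (p : ℝ) ≤ 1 := p.2.2

/-- The normed group structure with norm `‖x‖ ^ p`. -/
@[reducible] noncomputable def toNormedAddCommGroup (X : PBanachSpace.{u} p) :
    NormedAddCommGroup X :=
  letI G : AddGroupNorm X :=
    { toFun := fun x => ‖x‖ ^ (p : ℝ)
      map_zero' := by
        rw [(X.norm_eq_zero' 0).2 rfl, Real.zero_rpow (p_pos p).ne']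
      add_le' := X.norm_add_rpow_le
      neg' := fun x => by
        have h := X.norm_smul' (-1) x
        simp only [neg_smul, one_smul, abs_neg, abs_one, one_mul] at h
        rw [h]
      eq_zero_of_map_eq_zero' := fun x hx => by
        rwa [Real.rpow_eq_zero (X.norm_nonneg' x) (p_pos p).ne', X.norm_eq_zero'] at hx }
  AddGroupNorm.toNormedAddCommGroup G

/-- A complete normed group whose norm is `p`-homogeneous is a `p`-Banach space under the `p`-norm
`‖x‖ ^ (1 / p)`. -/
noncomputable def ofNormed (p : Set.Ioc (0 : ℝ) 1) (E : Type u) [N : NormedAddCommGroup E]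
    [Module ℝ E] [CompleteSpace E]
    (h : ∀ (a : ℝ) (x : E), N.toNorm.norm (a • x) = |a| ^ (p : ℝ) * N.toNorm.norm x) :
    PBanachSpace.{u} p :=
  { carrier := E
    norm := ⟨fun x => N.toNorm.norm x ^ (1 / (p : ℝ))⟩
    norm_nonneg' := fun x => Real.rpow_nonneg (norm_nonneg x) _
    norm_eq_zero' := fun x => by
      change N.toNorm.norm x ^ (1 / (p : ℝ)) = 0 ↔ x = 0
      rw [Real.rpow_eq_zero (norm_nonneg x) (one_div_pos.2 (p_pos p)).ne', norm_eq_zero]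
    norm_smul' := fun a x => by
      change N.toNorm.norm (a • x) ^ (1 / (p : ℝ)) = |a| * N.toNorm.norm x ^ (1 / (p : ℝ))
      rw [h, Real.mul_rpow (by positivity) (norm_nonneg x), one_div,
        Real.rpow_rpow_inv (abs_nonneg a) (p_pos p).ne']
    norm_add_rpow_le := fun x y => by
      change (N.toNorm.norm (x + y) ^ (1 / (p : ℝ))) ^ (p : ℝ) ≤
        (N.toNorm.norm x ^ (1 / (p : ℝ))) ^ (p : ℝ) + (N.toNorm.norm y ^ (1 / (p : ℝ))) ^ (p : ℝ)
      simp only [one_div]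
      rw [Real.rpow_inv_rpow (norm_nonneg _) (p_pos p).ne',
        Real.rpow_inv_rpow (norm_nonneg _) (p_pos p).ne',
        Real.rpow_inv_rpow (norm_nonneg _) (p_pos p).ne']
      exact norm_add_le x y
    exists_lim := fun s hs => by
      change ∀ ε : ℝ, 0 < ε → ∃ N' : ℕ, ∀ m ≥ N', ∀ n ≥ N',
        N.toNorm.norm (s m - s n) ^ (1 / (p : ℝ)) < ε at hs
      have hc : CauchySeq s := by
        rw [Metric.cauchySeq_iff]
        intro ε hε
        obtain ⟨K, hK⟩ := hs (ε ^ (1 / (p : ℝ))) (by positivity)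
        refine ⟨K, fun m hm n hn => ?_⟩
        rw [dist_eq_norm]
        exact (Real.rpow_lt_rpow_iff (norm_nonneg _) hε.le (one_div_pos.2 (p_pos p))).1
          (hK m hm n hn)
      obtain ⟨x, hx⟩ := cauchySeq_tendsto_of_complete hc
      refine ⟨x, ?_⟩
      change Tendsto (fun n => N.toNorm.norm (s n - x) ^ (1 / (p : ℝ))) atTop (𝓝 0)
      have h1 := (tendsto_iff_norm_sub_tendsto_zero.1 hx).rpow_const
        (p := 1 / (p : ℝ)) (Or.inr (one_div_pos.2 (p_pos p)).le)
      rwa [Real.zero_rpow (one_div_pos.2 (p_pos p)).ne'] at h1 }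

/-! ### `ℓ_p`-sums -/

/-- The underlying vector space of the `ℓ_p`-sum: families `x` with `∑ ‖x i‖ ^ p < ∞`. -/
def lpSubmodule {ι : Type} (X : ι → PBanachSpace.{u} p) : Submodule ℝ (∀ i, X i) where
  carrier := {x | Summable fun i => ‖x i‖ ^ (p : ℝ)}
  zero_mem' := by
    change Summable fun i => ‖(0 : X i)‖ ^ (p : ℝ)
    have h : ∀ i, ‖(0 : X i)‖ = 0 := fun i => ((X i).norm_eq_zero' 0).2 rfl
    simp only [h, Real.zero_rpow (p_pos p).ne']
    exact summable_zero
  add_mem' := fun {x y} hx hy =>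
    Summable.of_nonneg_of_le (fun i => Real.rpow_nonneg ((X i).norm_nonneg' _) _)
      (fun i => (X i).norm_add_rpow_le (x i) (y i)) (Summable.add hx hy)
  smul_mem' := fun a x hx => by
    change Summable fun i => ‖a • x i‖ ^ (p : ℝ)
    have h : ∀ i, ‖a • x i‖ ^ (p : ℝ) = |a| ^ (p : ℝ) * ‖x i‖ ^ (p : ℝ) := fun i => by
      rw [(X i).norm_smul', Real.mul_rpow (abs_nonneg a) ((X i).norm_nonneg' _)]
    simp only [h]
    exact Summable.mul_left _ hx

theorem rpow_norm_sum_le {ι : Type} {X : ι → PBanachSpace.{u} p} (x : lpSubmodule X) (i : ι) :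
    ‖x.1 i‖ ^ (p : ℝ) ≤ ∑' j, ‖x.1 j‖ ^ (p : ℝ) :=
  x.2.le_tsum i fun j _ => Real.rpow_nonneg ((X j).norm_nonneg' _) _

theorem tsum_rpow_nonneg {ι : Type} {X : ι → PBanachSpace.{u} p} (x : ∀ i, X i) :
    0 ≤ ∑' j, ‖x j‖ ^ (p : ℝ) :=
  tsum_nonneg fun j => Real.rpow_nonneg ((X j).norm_nonneg' _) _

theorem lp_exists_lim {ι : Type} (X : ι → PBanachSpace.{u} p) (s : ℕ → lpSubmodule X)
    (hs : ∀ ε : ℝ, 0 < ε → ∃ N : ℕ, ∀ m ≥ N, ∀ n ≥ N,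
      (∑' i, ‖(s m - s n).1 i‖ ^ (p : ℝ)) ^ (1 / (p : ℝ)) < ε) :
    ∃ x : lpSubmodule X,
      Tendsto (fun n => (∑' i, ‖(s n - x).1 i‖ ^ (p : ℝ)) ^ (1 / (p : ℝ))) atTop (𝓝 0) := by
  have hp := p_pos p
  have hp' : 0 < 1 / (p : ℝ) := one_div_pos.2 hp
  have hs' : ∀ ε : ℝ, 0 < ε → ∃ N : ℕ, ∀ m ≥ N, ∀ n ≥ N,
      ∑' i, ‖(s m - s n).1 i‖ ^ (p : ℝ) < ε := by
    intro ε hε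
    obtain ⟨N, hN⟩ := hs (ε ^ (1 / (p : ℝ))) (by positivity)
    exact ⟨N, fun m hm n hn =>
      (Real.rpow_lt_rpow_iff (tsum_rpow_nonneg _) hε.le hp').1 (hN m hm n hn)⟩
  have hlim : ∀ i, ∃ y : X i, Tendsto (fun n => ‖(s n).1 i - y‖) atTop (𝓝 0) := by
    intro i
    refine (X i).exists_lim (fun n => (s n).1 i) fun ε hε => ?_
    obtain ⟨N, hN⟩ := hs' (ε ^ (p : ℝ)) (by positivity)
    exact ⟨N, fun m hm n hn =>
      (Real.rpow_lt_rpow_iff ((X i).norm_nonneg' _) hε.le hp).1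
        ((rpow_norm_sum_le (s m - s n) i).trans_lt (hN m hm n hn))⟩
  choose y hy using hlim
  have hfin : ∀ ε : ℝ, 0 < ε → ∃ N : ℕ, ∀ m ≥ N, ∀ F : Finset ι,
      ∑ i ∈ F, ‖(s m).1 i - y i‖ ^ (p : ℝ) ≤ ε := by
    intro ε hε
    obtain ⟨N, hN⟩ := hs' ε hε
    refine ⟨N, fun m hm F => ?_⟩
    have h0 : Tendsto (fun n => ε + ∑ i ∈ F, ‖(s n).1 i - y i‖ ^ (p : ℝ)) atTop (𝓝 (ε + 0)) := by
      refine tendsto_const_nhds.add ?_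
      have : Tendsto (fun n => ∑ i ∈ F, ‖(s n).1 i - y i‖ ^ (p : ℝ)) atTop
          (𝓝 (∑ i ∈ F, (0 : ℝ))) :=
        tendsto_finsetSum _ fun i _ => by
          have h := (hy i).rpow_const (p := (p : ℝ)) (Or.inr hp.le)
          rwa [Real.zero_rpow hp.ne'] at h
      simpa using this
    rw [add_zero] at h0
    refine ge_of_tendsto h0 (eventually_atTop.2 ⟨N, fun n hn => ?_⟩)
    have h1 : ∑ i ∈ F, ‖(s m).1 i - y i‖ ^ (p : ℝ) ≤
        ∑ i ∈ F, (‖(s m - s n).1 i‖ ^ (p : ℝ) + ‖(s n).1 i - y i‖ ^ (p : ℝ)) := by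
      refine Finset.sum_le_sum fun i _ => ?_
      have h := (X i).norm_add_rpow_le ((s m - s n).1 i) ((s n).1 i - y i)
      have e : (s m - s n).1 i + ((s n).1 i - y i) = (s m).1 i - y i := by
        change (s m).1 i - (s n).1 i + ((s n).1 i - y i) = (s m).1 i - y i
        abel
      rwa [e] at h
    rw [Finset.sum_add_distrib] at h1
    have h2 := (s m - s n).2.sum_le_tsum F fun j _ =>
      Real.rpow_nonneg ((X j).norm_nonneg' _) _
    linarith [hN m hm n hn]
  have hsub : ∀ m, (fun i => (s m).1 i - y i) ∈ lpSubmodule X → y ∈ lpSubmodule X := by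
    intro m h
    have h2 := (lpSubmodule X).sub_mem (s m).2 h
    have e : ((s m).1 - fun i => (s m).1 i - y i) = y := by
      funext i
      simp
    rwa [e] at h2
  have hmem : y ∈ lpSubmodule X := by
    obtain ⟨N, hN⟩ := hfin 1 one_pos
    exact hsub N (summable_of_sum_le (fun i => Real.rpow_nonneg ((X i).norm_nonneg' _) _)
      (hN N le_rfl))
  refine ⟨⟨y, hmem⟩, ?_⟩
  have h1 : Tendsto (fun n => ∑' i, ‖(s n - ⟨y, hmem⟩ : lpSubmodule X).1 i‖ ^ (p : ℝ))
      atTop (𝓝 0) := by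
    rw [Metric.tendsto_atTop]
    intro ε hε
    obtain ⟨N, hN⟩ := hfin (ε / 2) (half_pos hε)
    refine ⟨N, fun n hn => ?_⟩
    rw [Real.dist_0_eq_abs, abs_of_nonneg (tsum_rpow_nonneg _)]
    exact ((s n - ⟨y, hmem⟩ : lpSubmodule X).2.tsum_le_of_sum_le (hN n hn)).trans_lt
      (half_lt_self hε)
  have h2 := h1.rpow_const (p := 1 / (p : ℝ)) (Or.inr hp'.le)
  rwa [Real.zero_rpow hp'.ne'] at h2

/-- The `ℓ_p`-sum of a family of `p`-Banach spaces, with the `p`-norm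
`‖x‖ = (∑ ‖x i‖ ^ p) ^ (1 / p)`. -/
noncomputable def lpSum {ι : Type} (X : ι → PBanachSpace.{u} p) : PBanachSpace.{u} p :=
  letI : Norm (lpSubmodule X) := ⟨fun x => (∑' i, ‖x.1 i‖ ^ (p : ℝ)) ^ (1 / (p : ℝ))⟩
  { carrier := lpSubmodule X
    norm_nonneg' := fun x => Real.rpow_nonneg (tsum_rpow_nonneg _) _
    norm_eq_zero' := fun x => by
      change (∑' i, ‖x.1 i‖ ^ (p : ℝ)) ^ (1 / (p : ℝ)) = 0 ↔ x = 0
      rw [Real.rpow_eq_zero (tsum_rpow_nonneg _) (one_div_pos.2 (p_pos p)).ne']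
      constructor
      · intro h
        refine Subtype.ext (funext fun i => ?_)
        have h1 := rpow_norm_sum_le x i
        rw [h] at h1
        have h2 := le_antisymm h1 (Real.rpow_nonneg ((X i).norm_nonneg' _) _)
        rwa [Real.rpow_eq_zero ((X i).norm_nonneg' _) (p_pos p).ne', (X i).norm_eq_zero'] at h2
      · rintro rfl
        have h : ∀ i, ‖(0 : X i)‖ = 0 := fun i => ((X i).norm_eq_zero' 0).2 rfl
        simp [h, Real.zero_rpow (p_pos p).ne']
    norm_smul' := fun a x => by
      change (∑' i, ‖a • x.1 i‖ ^ (p : ℝ)) ^ (1 / (p : ℝ)) =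
        |a| * (∑' i, ‖x.1 i‖ ^ (p : ℝ)) ^ (1 / (p : ℝ))
      have h : ∀ i, ‖a • x.1 i‖ ^ (p : ℝ) = |a| ^ (p : ℝ) * ‖x.1 i‖ ^ (p : ℝ) := fun i => by
        rw [(X i).norm_smul', Real.mul_rpow (abs_nonneg a) ((X i).norm_nonneg' _)]
      simp only [h]
      rw [tsum_mul_left, Real.mul_rpow (by positivity) (tsum_rpow_nonneg _), one_div,
        Real.rpow_rpow_inv (abs_nonneg a) (p_pos p).ne']
    norm_add_rpow_le := fun x y => by
      change ((∑' i, ‖x.1 i + y.1 i‖ ^ (p : ℝ)) ^ (1 / (p : ℝ))) ^ (p : ℝ) ≤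
        ((∑' i, ‖x.1 i‖ ^ (p : ℝ)) ^ (1 / (p : ℝ))) ^ (p : ℝ) +
        ((∑' i, ‖y.1 i‖ ^ (p : ℝ)) ^ (1 / (p : ℝ))) ^ (p : ℝ)
      simp only [one_div]
      rw [Real.rpow_inv_rpow (tsum_nonneg fun i => Real.rpow_nonneg ((X i).norm_nonneg' _) _)
          (p_pos p).ne',
        Real.rpow_inv_rpow (tsum_rpow_nonneg _) (p_pos p).ne',
        Real.rpow_inv_rpow (tsum_rpow_nonneg _) (p_pos p).ne']
      have hx : Summable fun i => ‖x.1 i‖ ^ (p : ℝ) := x.2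
      have hy : Summable fun i => ‖y.1 i‖ ^ (p : ℝ) := y.2
      rw [← Summable.tsum_add hx hy]
      exact Summable.tsum_le_tsum (fun i => (X i).norm_add_rpow_le _ _) (x + y).2 (hx.add hy)
    exists_lim := lp_exists_lim X }

end PBanachSpace

/-! ### Lipschitz free `p`-spaces -/

namespace LipschitzFree

open PBanachSpace

/-- The linear map sending a finitely supported family of coefficients `w` on pairs of points to
the molecule `∑ w (x, y) (δ_x - δ_y)`. -/
noncomputable def boundary (M : Type u) : ((M × M) →₀ ℝ) →ₗ[ℝ] (M →₀ ℝ) :=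
  Finsupp.lmapDomain ℝ ℝ Prod.fst - Finsupp.lmapDomain ℝ ℝ Prod.snd

/-- The space of molecules on `M`: the linear span of the differences `δ_x - δ_y`, that is, the
finitely supported functions on `M` of total mass `0`. -/
def Molecules (_p : Set.Ioc (0 : ℝ) 1) (M : Type u) : Type u :=
  LinearMap.range (boundary M)

variable (p : Set.Ioc (0 : ℝ) 1) (M : Type u)

noncomputable instance : AddCommGroup (Molecules p M) :=
  inferInstanceAs (AddCommGroup (LinearMap.range (boundary M)))

noncomputable instance : Module ℝ (Molecules p M) :=
  inferInstanceAs (Module ℝ (LinearMap.range (boundary M)))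

/-- The molecule `δ_x - δ_y`. -/
noncomputable def molecule {M : Type u} (x y : M) : Molecules p M :=
  ⟨Finsupp.single x 1 - Finsupp.single y 1, Finsupp.single (x, y) 1, by simp [boundary]⟩

variable {M} [MetricSpace M]

/-- The `p`-th power of the `p`-cost of the representation `∑ w (x, y) (δ_x - δ_y)` of a
molecule, namely `∑ (|w (x, y)| d (x, y)) ^ p`. -/
noncomputable def cost (w : (M × M) →₀ ℝ) : ℝ :=
  w.sum fun q a => (|a| * dist q.1 q.2) ^ (p : ℝ)

variable {p}

theorem cost_nonneg (w : (M × M) →₀ ℝ) : 0 ≤ cost p w :=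
  Finset.sum_nonneg fun _ _ => by positivity

theorem cost_add_le (v w : (M × M) →₀ ℝ) : cost p (v + w) ≤ cost p v + cost p w := by
  classical
  have h0 : ∀ q : M × M, (|(0 : ℝ)| * dist q.1 q.2) ^ (p : ℝ) = 0 := fun q => by
    simp [Real.zero_rpow (p_pos p).ne']
  have e : ∀ (z : (M × M) →₀ ℝ), z.support ⊆ v.support ∪ w.support →
      cost p z = ∑ q ∈ v.support ∪ w.support, (|z q| * dist q.1 q.2) ^ (p : ℝ) := fun z hz =>
    Finsupp.sum_of_support_subset _ hz _ fun q _ => h0 q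
  rw [e _ Finsupp.support_add, e v Finset.subset_union_left, e w Finset.subset_union_right,
    ← Finset.sum_add_distrib]
  refine Finset.sum_le_sum fun q _ => ?_
  refine le_trans ?_ (Real.rpow_add_le_add_rpow (by positivity) (by positivity)
    (p_pos p).le (p_le_one p))
  rw [← add_mul]
  exact Real.rpow_le_rpow (by positivity)
    (mul_le_mul_of_nonneg_right (abs_add_le _ _) dist_nonneg) (p_pos p).le

theorem cost_smul (a : ℝ) (w : (M × M) →₀ ℝ) : cost p (a • w) = |a| ^ (p : ℝ) * cost p w := by
  unfold cost
  rw [Finsupp.sum_smul_index' fun q => by simp [Real.zero_rpow (p_pos p).ne'], Finsupp.mul_sum]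
  refine Finsupp.sum_congr fun q _ => ?_
  rw [smul_eq_mul, abs_mul, mul_assoc, Real.mul_rpow (abs_nonneg a) (by positivity)]

/-- The `p`-th power of the `p`-norm of a molecule `μ`: the infimum of
`∑ (|w (x, y)| d (x, y)) ^ p` over all representations `μ = ∑ w (x, y) (δ_x - δ_y)`. -/
noncomputable def molNorm (μ : Molecules p M) : ℝ :=
  sInf {c : ℝ | ∃ w : (M × M) →₀ ℝ, boundary M w = μ.1 ∧ cost p w = c}

theorem molNorm_bddBelow (μ : Molecules p M) :
    BddBelow {c : ℝ | ∃ w : (M × M) →₀ ℝ, boundary M w = μ.1 ∧ cost p w = c} :=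
  ⟨0, by rintro _ ⟨w, -, rfl⟩; exact cost_nonneg w⟩

theorem molNorm_nonneg (μ : Molecules p M) : 0 ≤ molNorm μ :=
  Real.sInf_nonneg (by rintro _ ⟨w, -, rfl⟩; exact cost_nonneg w)

theorem molNorm_le {μ : Molecules p M} (w : (M × M) →₀ ℝ) (h : boundary M w = μ.1) :
    molNorm μ ≤ cost p w :=
  csInf_le (molNorm_bddBelow μ) ⟨w, h, rfl⟩

theorem exists_cost_lt (μ : Molecules p M) {ε : ℝ} (hε : 0 < ε) :
    ∃ w : (M × M) →₀ ℝ, boundary M w = μ.1 ∧ cost p w < molNorm μ + ε := by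
  obtain ⟨w₀, hw₀⟩ := μ.2
  obtain ⟨_, ⟨w, hw, rfl⟩, h⟩ := Real.lt_sInf_add_pos
    (s := {c : ℝ | ∃ w : (M × M) →₀ ℝ, boundary M w = μ.1 ∧ cost p w = c})
    ⟨_, w₀, hw₀, rfl⟩ hε
  exact ⟨w, hw, h⟩

theorem molNorm_add_le (μ ν : Molecules p M) : molNorm (μ + ν) ≤ molNorm μ + molNorm ν := by
  refine le_of_forall_pos_le_add fun ε hε => ?_
  obtain ⟨v, hv, hv'⟩ := exists_cost_lt μ (half_pos hε)
  obtain ⟨w, hw, hw'⟩ := exists_cost_lt ν (half_pos hε)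
  have h := molNorm_le (μ := μ + ν) (v + w) (by rw [map_add, hv, hw]; rfl)
  linarith [cost_add_le (p := p) v w]

theorem molNorm_smul_le (a : ℝ) (μ : Molecules p M) :
    molNorm (a • μ) ≤ |a| ^ (p : ℝ) * molNorm μ := by
  refine le_of_forall_pos_le_add fun ε hε => ?_
  have hA : 0 < |a| ^ (p : ℝ) + 1 := by positivity
  obtain ⟨w, hw, hw'⟩ := exists_cost_lt μ (div_pos hε hA)
  have h := molNorm_le (μ := a • μ) (a • w) (by rw [map_smul, hw]; rfl)
  rw [cost_smul] at h
  have h1 : |a| ^ (p : ℝ) * cost p w ≤ |a| ^ (p : ℝ) * (molNorm μ + ε / (|a| ^ (p : ℝ) + 1)) :=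
    mul_le_mul_of_nonneg_left hw'.le (by positivity)
  have h2 : |a| ^ (p : ℝ) * (ε / (|a| ^ (p : ℝ) + 1)) ≤ ε := by
    rw [mul_div_assoc', div_le_iff₀ hA]
    nlinarith
  linarith

theorem molNorm_zero : molNorm (0 : Molecules p M) = 0 :=
  le_antisymm ((molNorm_le 0 (map_zero _)).trans_eq (by simp [cost])) (molNorm_nonneg _)

theorem molNorm_smul (a : ℝ) (μ : Molecules p M) :
    molNorm (a • μ) = |a| ^ (p : ℝ) * molNorm μ := by
  refine le_antisymm (molNorm_smul_le a μ) ?_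
  rcases eq_or_ne a 0 with rfl | ha
  · simp [Real.zero_rpow (p_pos p).ne', molNorm_zero]
  · have h := molNorm_smul_le a⁻¹ (a • μ)
    rw [inv_smul_smul₀ ha] at h
    have hA : 0 < |a| ^ (p : ℝ) := Real.rpow_pos_of_pos (abs_pos.2 ha) _
    calc |a| ^ (p : ℝ) * molNorm μ
        ≤ |a| ^ (p : ℝ) * (|a⁻¹| ^ (p : ℝ) * molNorm (a • μ)) :=
          mul_le_mul_of_nonneg_left h hA.le
      _ = molNorm (a • μ) := by
          rw [abs_inv, Real.inv_rpow (abs_nonneg a), mul_inv_cancel_left₀ hA.ne']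

noncomputable instance : SeminormedAddCommGroup (Molecules p M) :=
  AddGroupSeminorm.toSeminormedAddCommGroup
    { toFun := molNorm
      map_zero' := molNorm_zero
      add_le' := molNorm_add_le
      neg' := fun μ => by
        rw [← neg_one_smul ℝ μ, molNorm_smul]
        simp }

theorem norm_molecules_eq (μ : Molecules p M) : ‖μ‖ = molNorm μ := rfl

noncomputable instance : UniformContinuousConstSMul ℝ (Molecules p M) where
  uniformContinuous_const_smul a := by
    refine (LipschitzWith.of_dist_le_mul (K := ⟨|a| ^ (p : ℝ), by positivity⟩)
      fun μ ν => ?_).uniformContinuous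
    rw [dist_eq_norm, dist_eq_norm, ← smul_sub, norm_molecules_eq, molNorm_smul]
    exact le_rfl

theorem norm_completion_smul (a : ℝ) (ξ : UniformSpace.Completion (Molecules p M)) :
    ‖a • ξ‖ = |a| ^ (p : ℝ) * ‖ξ‖ := by
  induction ξ using UniformSpace.Completion.induction_on with
  | hp => exact isClosed_eq (continuous_const_smul a).norm (continuous_const.mul continuous_norm)
  | ih μ =>
    rw [← UniformSpace.Completion.coe_smul, UniformSpace.Completion.norm_coe,
      UniformSpace.Completion.norm_coe]
    exact molNorm_smul a μ

end LipschitzFree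

open LipschitzFree in
/-- The Lipschitz free `p`-space `F_p(M)` over a metric space `M`: the completion of the space of
molecules on `M` under the `p`-norm
`‖μ‖ = inf (∑ (|w (x, y)| d (x, y)) ^ p) ^ (1 / p)`, the infimum being over all representations
`μ = ∑ w (x, y) (δ_x - δ_y)`. -/
noncomputable def lipschitzFreeSpace (p : Set.Ioc (0 : ℝ) 1) (M : Type u) [MetricSpace M] :
    PBanachSpace.{u} p :=
  PBanachSpace.ofNormed p (UniformSpace.Completion (Molecules p M)) norm_completion_smul

open LipschitzFree in
/-- The canonical embedding `δ : M → F_p(M)`, `δ(x) = δ_x - δ_o`, for the base point `o`. -/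
noncomputable def lipschitzFreeDelta (p : Set.Ioc (0 : ℝ) 1) {M : Type u} [MetricSpace M]
    (o x : M) : lipschitzFreeSpace p M :=
  ((molecule p x o : Molecules p M) : UniformSpace.Completion (Molecules p M))

/-- A topological space is scattered: some Cantor-Bendixson derivative of it is empty. -/
def IsScattered (M : Type u) [TopologicalSpace M] : Prop :=
  ∃ α : Ordinal.{u}, CantorBendixson.iteratedDerivedSet (Set.univ : Set M) α = ∅

/-! ### The universal property of `F_p(M)` -/

namespace LipschitzFree

open PBanachSpace UniformSpace

variable {p : Set.Ioc (0 : ℝ) 1} {M : Type u}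

theorem linearCombination_boundary {E : Type*} [AddCommGroup E] [Module ℝ E] (f : M → E)
    (w : (M × M) →₀ ℝ) : Finsupp.linearCombination ℝ f (boundary M w) =
      w.sum fun q a => a • (f q.1 - f q.2) := by
  rw [boundary, LinearMap.sub_apply, map_sub, Finsupp.lmapDomain_apply, Finsupp.lmapDomain_apply,
    Finsupp.linearCombination_mapDomain, Finsupp.linearCombination_mapDomain,
    Finsupp.linearCombination_apply, Finsupp.linearCombination_apply, ← Finsupp.sum_sub]
  simp only [Function.comp_apply, smul_sub]

theorem sum_rpow_le {ι : Type*} (s : Finset ι) (c : ι → ℝ) (hc : ∀ i, 0 ≤ c i) :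
    (∑ i ∈ s, c i) ^ (p : ℝ) ≤ ∑ i ∈ s, c i ^ (p : ℝ) := by
  classical
  induction s using Finset.induction_on with
  | empty => simp [Real.zero_rpow (p_pos p).ne']
  | insert i s hi ih =>
    rw [Finset.sum_insert hi, Finset.sum_insert hi]
    have h := Real.rpow_add_le_add_rpow (hc i) (Finset.sum_nonneg fun j (_ : j ∈ s) => hc j)
      (p_pos p).le (p_le_one p)
    linarith

variable [MetricSpace M]

theorem exists_lift {E : Type u} [NormedAddCommGroup E] [Module ℝ E] [CompleteSpace E]
    (hE : ∀ (a : ℝ) (x : E), ‖a • x‖ = |a| ^ (p : ℝ) * ‖x‖) (f : M → E) (K : ℝ) (hK : 0 ≤ K)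
    (hf : ∀ x y, ‖f x - f y‖ ≤ K * dist x y ^ (p : ℝ)) :
    ∃ T : Completion (Molecules p M) →ₗ[ℝ] E, (∀ ξ, ‖T ξ‖ ≤ K * ‖ξ‖) ∧
      ∀ x y, T ((molecule p x y : Molecules p M) : Completion (Molecules p M)) = f x - f y := by
  have hcont : ∀ a : ℝ, Continuous fun x : E => a • x := fun a => by
    refine (LipschitzWith.of_dist_le_mul (K := ⟨|a| ^ (p : ℝ), by positivity⟩)
      fun x y => ?_).continuous
    rw [dist_eq_norm, dist_eq_norm, ← smul_sub, hE]
    exact le_rfl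
  let Φ : (M →₀ ℝ) →ₗ[ℝ] E := Finsupp.linearCombination ℝ f
  have hΦ : ∀ w, Φ (boundary M w) = w.sum fun q a => a • (f q.1 - f q.2) :=
    linearCombination_boundary f
  let T₀ : Molecules p M →+ E :=
    (Φ.comp (LinearMap.range (boundary M)).subtype).toAddMonoidHom
  have hT₀ : ∀ μ, T₀ μ = Φ μ.1 := fun _ => rfl
  have hbd : ∀ μ, ‖T₀ μ‖ ≤ K * ‖μ‖ := fun μ => by
    refine le_of_forall_pos_le_add fun ε hε => ?_
    have hA : 0 < K + 1 := by positivity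
    obtain ⟨w, hw, hw'⟩ := exists_cost_lt μ (div_pos hε hA)
    have h1 : ‖T₀ μ‖ ≤ K * cost p w := by
      rw [hT₀, ← hw, hΦ, cost, Finsupp.mul_sum]
      refine (norm_sum_le _ _).trans (Finset.sum_le_sum fun q _ => ?_)
      change ‖w q • (f q.1 - f q.2)‖ ≤ K * (|w q| * dist q.1 q.2) ^ (p : ℝ)
      rw [hE, Real.mul_rpow (abs_nonneg _) dist_nonneg, mul_left_comm]
      exact mul_le_mul_of_nonneg_left (hf _ _) (by positivity)
    have h2 : K * cost p w ≤ K * (molNorm μ + ε / (K + 1)) :=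
      mul_le_mul_of_nonneg_left hw'.le hK
    have h3 : K * (ε / (K + 1)) ≤ ε := by
      rw [mul_div_assoc', div_le_iff₀ hA]
      nlinarith
    rw [norm_molecules_eq]
    linarith
  have hT₀c : Continuous T₀ := AddMonoidHomClass.continuous_of_bound T₀ K hbd
  let T := T₀.extension hT₀c
  have hTc : Continuous T := T₀.continuous_extension hT₀c
  have hTcoe : ∀ μ : Molecules p M, T (μ : Completion (Molecules p M)) = T₀ μ :=
    fun μ => T₀.extension_coe hT₀c μ
  refine ⟨{ T with map_smul' := fun a ξ => ?_ }, fun ξ => ?_, fun x y => ?_⟩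
  · change T (a • ξ) = a • T ξ
    induction ξ using Completion.induction_on with
    | hp => exact isClosed_eq (hTc.comp (continuous_const_smul a)) ((hcont a).comp hTc)
    | ih μ =>
      rw [← Completion.coe_smul, hTcoe, hTcoe]
      exact map_smul (Φ.comp (LinearMap.range (boundary M)).subtype) a μ
  · change ‖T ξ‖ ≤ K * ‖ξ‖
    induction ξ using Completion.induction_on with
    | hp => exact isClosed_le hTc.norm (continuous_const.mul continuous_norm)
    | ih μ =>
      rw [hTcoe, Completion.norm_coe]
      exact hbd μ
  · change T _ = _
    rw [hTcoe, hT₀]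
    simp [Φ, molecule]

theorem lift_unique {E : Type u} [NormedAddCommGroup E] [Module ℝ E]
    (S T : Completion (Molecules p M) →ₗ[ℝ] E) (hS : ∃ C : ℝ, ∀ ξ, ‖S ξ‖ ≤ C * ‖ξ‖)
    (hT : ∃ C : ℝ, ∀ ξ, ‖T ξ‖ ≤ C * ‖ξ‖) (o : M)
    (h : ∀ x, S ((molecule p x o : Molecules p M) : Completion (Molecules p M)) =
      T ((molecule p x o : Molecules p M) : Completion (Molecules p M))) : S = T := by
  obtain ⟨C, hC⟩ := hS
  obtain ⟨D, hD⟩ := hT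
  refine LinearMap.ext fun ξ => ?_
  induction ξ using Completion.induction_on with
  | hp =>
    exact isClosed_eq (AddMonoidHomClass.continuous_of_bound S C hC)
      (AddMonoidHomClass.continuous_of_bound T D hD)
  | ih μ =>
    obtain ⟨w, hw⟩ := μ.2
    let ι : Molecules p M →ₗ[ℝ] Completion (Molecules p M) :=
      { toFun := fun ν => ν
        map_add' := fun a b => Completion.coe_add a b
        map_smul' := fun a b => Completion.coe_smul a b }
    let b : ((M × M) →₀ ℝ) →ₗ[ℝ] Molecules p M := (boundary M).rangeRestrict
    have hb : b w = μ := Subtype.ext hw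
    have hmol : ∀ q : M × M, b (Finsupp.single q 1) = molecule p q.1 o - molecule p q.2 o := by
      intro q
      refine Subtype.ext ?_
      change boundary M (Finsupp.single q 1) =
        (Finsupp.single q.1 1 - Finsupp.single o 1) - (Finsupp.single q.2 1 - Finsupp.single o 1)
      simp [boundary]
    have key : (S ∘ₗ ι) ∘ₗ b = (T ∘ₗ ι) ∘ₗ b := by
      refine Finsupp.lhom_ext' fun q => LinearMap.ext_ring ?_
      change S (ι (b (Finsupp.single q 1))) = T (ι (b (Finsupp.single q 1)))
      rw [hmol, map_sub, map_sub, map_sub]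
      exact congrArg₂ _ (h q.1) (h q.2)
    have h2 := LinearMap.congr_fun key w
    change S (ι (b w)) = T (ι (b w)) at h2
    rwa [hb] at h2

end LipschitzFree

namespace PBanachSpace

variable {p : Set.Ioc (0 : ℝ) 1}

theorem completeSpace_toNormed (X : PBanachSpace.{u} p) :
    @CompleteSpace X X.toNormedAddCommGroup.toMetricSpace.toUniformSpace := by
  let := X.toNormedAddCommGroup
  refine Metric.complete_of_cauchySeq_tendsto fun s hs => ?_
  have hp := p_pos p
  have hd : ∀ x y : X, dist x y = X.norm.norm (x - y) ^ (p : ℝ) := fun x y => dist_eq_norm x y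
  obtain ⟨x, hx⟩ := X.exists_lim s fun ε hε => by
    obtain ⟨N, hN⟩ := Metric.cauchySeq_iff.1 hs (ε ^ (p : ℝ)) (by positivity)
    refine ⟨N, fun m hm n hn => ?_⟩
    have h := hN m hm n hn
    rw [hd] at h
    exact (Real.rpow_lt_rpow_iff (X.norm_nonneg' _) hε.le hp).1 h
  refine ⟨x, tendsto_iff_dist_tendsto_zero.2 ?_⟩
  have h1 := hx.rpow_const (p := (p : ℝ)) (Or.inr hp.le)
  rw [Real.zero_rpow hp.ne'] at h1
  simpa only [hd] using h1

end PBanachSpace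

open LipschitzFree PBanachSpace in
/-- The embedding `δ` is isometric. -/
theorem norm_lipschitzFreeDelta_sub (p : Set.Ioc (0 : ℝ) 1) {M : Type u} [MetricSpace M]
    (o x y : M) : ‖lipschitzFreeDelta p o x - lipschitzFreeDelta p o y‖ = dist x y := by
  have hp := p_pos p
  have e : lipschitzFreeDelta p o x - lipschitzFreeDelta p o y =
      ((molecule p x y : Molecules p M) : UniformSpace.Completion (Molecules p M)) := by
    change ((molecule p x o : Molecules p M) : UniformSpace.Completion (Molecules p M)) -
      ((molecule p y o : Molecules p M) : UniformSpace.Completion (Molecules p M)) = _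
    rw [← UniformSpace.Completion.coe_sub]
    congr 1
    refine Subtype.ext ?_
    change (Finsupp.single x 1 - Finsupp.single o 1) -
      (Finsupp.single y 1 - Finsupp.single o 1) = Finsupp.single x (1 : ℝ) - Finsupp.single y 1
    abel
  rw [e]
  change ‖((molecule p x y : Molecules p M) : UniformSpace.Completion (Molecules p M))‖ ^
    (1 / (p : ℝ)) = _
  rw [UniformSpace.Completion.norm_coe, norm_molecules_eq]
  suffices h : molNorm (molecule p x y) = dist x y ^ (p : ℝ) by
    rw [h, one_div, Real.rpow_rpow_inv dist_nonneg hp.ne']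
  refine le_antisymm ((molNorm_le (Finsupp.single (x, y) 1) (by simp [boundary, molecule])).trans
    (by rw [cost, Finsupp.sum_single_index (by simp [Real.zero_rpow hp.ne'])]; simp)) ?_
  refine le_csInf ⟨_, Finsupp.single (x, y) 1, by simp [boundary, molecule], rfl⟩ ?_
  rintro _ ⟨w, hw, rfl⟩
  have h1 := congrArg (Finsupp.linearCombination ℝ fun z => dist z y) hw
  have h2 : Finsupp.linearCombination ℝ (fun z => dist z y) (boundary M w) =
      w.sum fun q a => a * (dist q.1 y - dist q.2 y) :=
    linearCombination_boundary _ w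
  have h3 : Finsupp.linearCombination ℝ (fun z => dist z y) (molecule p x y).1 = dist x y := by
    simp [molecule]
  rw [h2, h3] at h1
  have h4 : dist x y ≤ ∑ q ∈ w.support, |w q| * dist q.1 q.2 := by
    rw [← h1]
    refine Finset.sum_le_sum fun q _ => (le_abs_self _).trans ?_
    rw [abs_mul]
    exact mul_le_mul_of_nonneg_left (abs_dist_sub_le _ _ _) (abs_nonneg _)
  exact (Real.rpow_le_rpow dist_nonneg h4 hp.le).trans
    (sum_rpow_le _ _ fun _ => by positivity)

open LipschitzFree PBanachSpace in
/-- The universal property of `F_p(M)`: a Lipschitz map `f : M → X` into a `p`-Banach space with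
`f o = 0` factors through `δ` by exactly one bounded linear map, and that map is bounded by the
Lipschitz constant of `f`. -/
theorem lipschitzFreeSpace_universal (p : Set.Ioc (0 : ℝ) 1) {M : Type u} [MetricSpace M] (o : M)
    (X : PBanachSpace.{u} p) (f : M → X) (L : ℝ) (hL : 0 ≤ L)
    (hf : ∀ x y, ‖f x - f y‖ ≤ L * dist x y) (h0 : f o = 0) :
    ∃ T : lipschitzFreeSpace p M →ₗ[ℝ] X,
      ((∀ ξ, ‖T ξ‖ ≤ L * ‖ξ‖) ∧ ∀ x, T (lipschitzFreeDelta p o x) = f x) ∧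
      ∀ S : lipschitzFreeSpace p M →ₗ[ℝ] X, IsBounded S →
        (∀ x, S (lipschitzFreeDelta p o x) = f x) → S = T := by
  have hp := p_pos p
  have hE : ∀ (a : ℝ) (x : X),
      X.toNormedAddCommGroup.toNorm.norm (a • x) =
        |a| ^ (p : ℝ) * X.toNormedAddCommGroup.toNorm.norm x := fun a x => by
    change ‖a • x‖ ^ (p : ℝ) = |a| ^ (p : ℝ) * ‖x‖ ^ (p : ℝ)
    rw [X.norm_smul', Real.mul_rpow (abs_nonneg a) (X.norm_nonneg' x)]
  have hconv : ∀ (S : lipschitzFreeSpace p M →ₗ[ℝ] X) (C : ℝ), 0 ≤ C →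
      (∀ ξ, ‖S ξ‖ ≤ C * ‖ξ‖) → ∀ ξ : UniformSpace.Completion (Molecules p M),
      X.toNormedAddCommGroup.toNorm.norm (S ξ) ≤ C ^ (p : ℝ) * ‖ξ‖ := fun S C hC h ξ => by
    have h1 := Real.rpow_le_rpow (X.norm_nonneg' _) (h ξ) hp.le
    change ‖S ξ‖ ^ (p : ℝ) ≤ (C * ‖ξ‖ ^ (1 / (p : ℝ))) ^ (p : ℝ) at h1
    rwa [Real.mul_rpow hC (by positivity), one_div,
      Real.rpow_inv_rpow (norm_nonneg _) hp.ne'] at h1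
  obtain ⟨T, hT, hTf⟩ := @exists_lift p M _ X X.toNormedAddCommGroup X.module
    X.completeSpace_toNormed hE f (L ^ (p : ℝ)) (by positivity) fun x y => by
      have h1 := Real.rpow_le_rpow (X.norm_nonneg' _) (hf x y) hp.le
      rwa [Real.mul_rpow hL dist_nonneg] at h1
  have hTδ : ∀ x, T (lipschitzFreeDelta p o x) = f x := fun x =>
    (hTf x o).trans (by rw [h0]; exact sub_zero _)
  have hTb : ∀ ξ : lipschitzFreeSpace p M, X.norm.norm (T ξ) ≤ L * ‖ξ‖ := fun ξ => by
    have h1 : X.norm.norm (T ξ) ^ (p : ℝ) ≤ L ^ (p : ℝ) *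
      norm (E := UniformSpace.Completion (Molecules p M)) ξ := hT ξ
    have h2 := Real.rpow_le_rpow (Real.rpow_nonneg (X.norm_nonneg' _) _) h1
      (inv_pos.2 hp).le
    rw [Real.rpow_rpow_inv (X.norm_nonneg' _) hp.ne', Real.mul_rpow (by positivity)
      (norm_nonneg (E := UniformSpace.Completion (Molecules p M)) ξ),
      Real.rpow_rpow_inv hL hp.ne', ← one_div] at h2
    exact h2
  refine ⟨T, ⟨hTb, hTδ⟩, fun S ⟨C, hC⟩ hS => ?_⟩
  have hC' : ∀ ξ : lipschitzFreeSpace p M, ‖S ξ‖ ≤ |C| * ‖ξ‖ := fun ξ =>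
    (hC ξ).trans (mul_le_mul_of_nonneg_right (le_abs_self C)
      ((lipschitzFreeSpace p M).norm_nonneg' ξ))
  exact @lift_unique p M _ X X.toNormedAddCommGroup X.module S T
    ⟨_, hconv S |C| (abs_nonneg C) hC'⟩ ⟨_, hT⟩ o fun x => (hS x).trans (hTδ x).symm

/-!
The proof reduces `F_p(M)` to finite-dimensional spaces by decompositions along Lipschitz partitions
of unity, which need no extension of Lipschitz maps and so work for all `p ≤ 1`.

Let `N` be a metric space with base point `b`, and let `φ n` be a partition of unity on `N ∖ {b}`
of bounded multiplicity such that `φ n` has Lipschitz constant of order `1 / dist x b` at the points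
`x` of its support. Then `δ x ↦ (φ n x • δ x)` is a Lipschitz map into the `ℓ_p`-sum of the
free spaces over the supports (with `b` adjoined), so it extends to a bounded operator on `F_p(N)`,
and the sum of the canonical maps back to `F_p(N)` is a left inverse. Hence `F_p(N)` is isomorphic
to a complemented subspace of that `ℓ_p`-sum, and a stable property passes from the pieces to `N`
(`of_partition`). There are two applications.

* Kalton's decomposition (`of_dyadicAnnulus`): it suffices to treat the dyadic annuli around a
  point `b`, each with `b` adjoined.
* Gluing (`HoldsNear.union`): on a bounded set every Lipschitz partition of unity is admissible, so
  the property `HoldsNear`, which quantifies over all compact sets near a given set together with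
  arbitrary finite sets, is stable under finite unions. By compactness it is then local
  (`holdsNear_of_isCompact`).

The set `U` of points near which the property holds is open. If `U` were not the whole of `M`, its
closed complement would have a relatively isolated point `x`, because `M` is scattered. The
annuli around `x` inside a small compact set containing `x` are compact subsets of `U`, so Kalton's
decomposition at `x` gives `x ∈ U`, a contradiction (`holdsNear_of_isScattered`). Thus the property
holds near every compact set, and one more use of Kalton's decomposition, on all of `M`, whose
annuli are compact because `M` is proper, gives the theorem. This replaces a transfinite
induction on the Cantor-Bendixson rank.
-/

/-! ### Properties of `p`-Banach spaces and complemented copies -/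

namespace PBanachSpace

variable {p : Set.Ioc (0 : ℝ) 1}

/-- The stability hypotheses on a property of `p`-Banach spaces: it holds for finite-dimensional
spaces and passes to countable `ℓ_p`-sums, isomorphic copies and complemented subspaces. -/
structure IsStableProperty (P : PBanachSpace.{u} p → Prop) : Prop where
  of_finiteDimensional : ∀ X : PBanachSpace.{u} p, FiniteDimensional ℝ X → P X
  lpSum : ∀ X : ℕ → PBanachSpace.{u} p, (∀ n, P (X n)) → P (PBanachSpace.lpSum X)
  of_isomorphic : ∀ X Y : PBanachSpace.{u} p, Isomorphic X Y → P X → P Y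
  of_isComplemented : ∀ (X : PBanachSpace.{u} p) (S : Submodule ℝ X) (hS : X.IsClosedSubspace S),
    X.IsComplemented S → P X → P (X.subspace S hS)

theorem IsBounded.exists_nonneg {X Y : PBanachSpace.{u} p} {T : X →ₗ[ℝ] Y} (hT : IsBounded T) :
    ∃ C : ℝ, 0 ≤ C ∧ ∀ x : X, ‖T x‖ ≤ C * ‖x‖ := by
  obtain ⟨C, hC⟩ := hT
  exact ⟨|C|, abs_nonneg C, fun x =>
    (hC x).trans (mul_le_mul_of_nonneg_right (le_abs_self C) (X.norm_nonneg' x))⟩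

theorem IsBounded.comp {X Y Z : PBanachSpace.{u} p} {S : Y →ₗ[ℝ] Z} {T : X →ₗ[ℝ] Y}
    (hS : IsBounded S) (hT : IsBounded T) : IsBounded (S ∘ₗ T) := by
  obtain ⟨C, hC0, hC⟩ := hS.exists_nonneg
  obtain ⟨D, hD⟩ := hT
  refine ⟨C * D, fun x => (hC _).trans ?_⟩
  rw [mul_assoc]
  exact mul_le_mul_of_nonneg_left (hD x) hC0

theorem norm_sub_rev' (X : PBanachSpace.{u} p) (x y : X) : ‖x - y‖ = ‖y - x‖ := by
  have h := X.norm_smul' (-1) (x - y)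
  simp only [neg_smul, one_smul, abs_neg, abs_one, one_mul, neg_sub] at h
  exact h.symm

theorem eq_of_tendsto (X : PBanachSpace.{u} p) {s : ℕ → X} {x y : X}
    (hx : Tendsto (fun n => ‖s n - x‖) atTop (𝓝 0))
    (hy : Tendsto (fun n => ‖s n - y‖) atTop (𝓝 0)) : x = y := by
  have hp := p_pos p
  have hx' := hx.rpow_const (p := (p : ℝ)) (Or.inr hp.le)
  have hy' := hy.rpow_const (p := (p : ℝ)) (Or.inr hp.le)
  rw [Real.zero_rpow hp.ne'] at hx' hy'
  have h : ‖x - y‖ ^ (p : ℝ) ≤ 0 + 0 := by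
    refine ge_of_tendsto' (hx'.add hy') fun n => ?_
    have h1 := X.norm_add_rpow_le (x - s n) (s n - y)
    rwa [sub_add_sub_cancel, X.norm_sub_rev' x (s n)] at h1
  rw [add_zero] at h
  have h2 := le_antisymm h (Real.rpow_nonneg (X.norm_nonneg' _) _)
  rwa [Real.rpow_eq_zero (X.norm_nonneg' _) hp.ne', X.norm_eq_zero', sub_eq_zero] at h2

/-- A space through which the identity of `X` factors contains a complemented copy of `X`. -/
theorem IsStableProperty.of_leftInverse {P : PBanachSpace.{u} p → Prop} (hP : IsStableProperty P)
    {X Y : PBanachSpace.{u} p} (T : X →ₗ[ℝ] Y) (S : Y →ₗ[ℝ] X) (hT : IsBounded T)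
    (hS : IsBounded S) (hST : ∀ x, S (T x) = x) (hY : P Y) : P X := by
  have hπ : IsBounded (T ∘ₗ S) := hT.comp hS
  have hfix : ∀ y ∈ LinearMap.range T, (T ∘ₗ S) y = y := by
    rintro _ ⟨x, rfl⟩
    simp [hST]
  have hcl : Y.IsClosedSubspace (LinearMap.range T) := by
    intro s y hs hy
    obtain ⟨C, hC⟩ := hπ
    have h0 : Tendsto (fun n => ‖s n - (T ∘ₗ S) y‖) atTop (𝓝 0) := by
      refine squeeze_zero (fun n => Y.norm_nonneg' _) (fun n => ?_) (by simpa using hy.const_mul C)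
      have h1 := hC (s n - y)
      rwa [map_sub, hfix _ (hs n)] at h1
    rw [Y.eq_of_tendsto hy h0]
    exact ⟨S y, rfl⟩
  have hc : P (Y.subspace (LinearMap.range T) hcl) :=
    hP.of_isComplemented Y _ hcl ⟨T ∘ₗ S, hπ, fun x => ⟨S x, rfl⟩, hfix⟩ hY
  let e : X ≃ₗ[ℝ] LinearMap.range T := LinearEquiv.ofLeftInverse (g := S) hST
  have hsymm : ∀ y : LinearMap.range T, e.symm y = S y.1 := fun y =>
    LinearEquiv.ofLeftInverse_symm_apply hST y
  obtain ⟨C, hC⟩ := hT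
  obtain ⟨D, hD⟩ := hS
  exact hP.of_isomorphic (Y.subspace (LinearMap.range T) hcl) X ⟨e.symm,
    ⟨D, fun y => (congrArg _ (hsymm y)).trans_le (hD y.1)⟩, ⟨C, hC⟩⟩ hc

/-- Operators `g n : X n → E` with uniformly controlled norms add up to an operator on the
`ℓ_p`-sum of the `X n`. The space `E` carries the norm `‖·‖ ^ p` of a `p`-Banach space. -/
theorem exists_lpSum_desc {E : Type u} [NormedAddCommGroup E] [Module ℝ E] [CompleteSpace E]
    (hE : ∀ (a : ℝ) (x : E), ‖a • x‖ = |a| ^ (p : ℝ) * ‖x‖) (X : ℕ → PBanachSpace.{u} p)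
    (g : ∀ n, X n →ₗ[ℝ] E) (hg : ∀ n x, ‖g n x‖ ≤ ‖x‖ ^ (p : ℝ)) :
    ∃ S : lpSum X →ₗ[ℝ] E, (∀ x, ‖S x‖ ≤ ‖x‖ ^ (p : ℝ)) ∧
      ∀ x : lpSubmodule X, S x = ∑' n, g n (x.1 n) := by
  have : ContinuousConstSMul ℝ E := ⟨fun a => by
    refine (LipschitzWith.of_dist_le_mul (K := ⟨|a| ^ (p : ℝ), by positivity⟩)
      fun x y => ?_).continuous
    rw [dist_eq_norm, dist_eq_norm, ← smul_sub, hE]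
    exact le_rfl⟩
  have hs : ∀ x : lpSubmodule X, Summable fun n => ‖g n (x.1 n)‖ := fun x =>
    Summable.of_nonneg_of_le (fun n => norm_nonneg _) (fun n => hg n _) x.2
  let S : lpSubmodule X →ₗ[ℝ] E :=
    { toFun := fun x => ∑' n, g n (x.1 n)
      map_add' := fun x y => by
        rw [← (hs x).of_norm.tsum_add (hs y).of_norm]
        exact tsum_congr fun n => map_add (g n) _ _
      map_smul' := fun a x => by
        rw [RingHom.id_apply, ← (hs x).of_norm.tsum_const_smul]
        exact tsum_congr fun n => map_smul (g n) _ _ }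
  refine ⟨S, fun x => ?_, fun x => rfl⟩
  change ‖∑' n, g n (x.1 n)‖ ≤ ((∑' n, ‖x.1 n‖ ^ (p : ℝ)) ^ (1 / (p : ℝ))) ^ (p : ℝ)
  rw [one_div, Real.rpow_inv_rpow (tsum_rpow_nonneg _) (p_pos p).ne']
  exact (norm_tsum_le_tsum_norm (hs x)).trans ((hs x).tsum_le_tsum (fun n => hg n _) x.2)

end PBanachSpace

/-! ### Free spaces over finite metric spaces -/

namespace LipschitzFree

open PBanachSpace UniformSpace

variable {p : Set.Ioc (0 : ℝ) 1}

instance continuousSMul_completion (M : Type u) [MetricSpace M] :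
    ContinuousSMul ℝ (Completion (Molecules p M)) := by
  have hp := p_pos p
  have h0 : Tendsto (fun a : ℝ => |a| ^ (p : ℝ)) (𝓝 0) (𝓝 0) := by
    have h := ((continuous_abs (G := ℝ)).tendsto 0).rpow_const (p := (p : ℝ)) (Or.inr hp.le)
    rwa [abs_zero, Real.zero_rpow hp.ne'] at h
  refine ContinuousSMul.of_nhds_zero ?_ (fun ξ => ?_) (fun a => ?_)
  · rw [tendsto_zero_iff_norm_tendsto_zero]
    simp only [norm_completion_smul]
    simpa using (h0.comp tendsto_fst).mul
      ((tendsto_zero_iff_norm_tendsto_zero.1 tendsto_id).comp tendsto_snd)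
  · rw [tendsto_zero_iff_norm_tendsto_zero]
    simp only [norm_completion_smul]
    simpa using h0.mul_const ‖ξ‖
  · simpa using (continuous_const_smul a).tendsto (0 : Completion (Molecules p M))

/-- Molecules on a finite metric space form a finite-dimensional, hence closed, dense subspace of
the free space. -/
theorem finiteDimensional_lipschitzFreeSpace (M : Type u) [MetricSpace M] [Finite M] :
    FiniteDimensional ℝ (lipschitzFreeSpace p M) := by
  let ι : Molecules p M →ₗ[ℝ] Completion (Molecules p M) :=
    { toFun := fun ν => ν
      map_add' := fun a b => Completion.coe_add a b
      map_smul' := fun a b => Completion.coe_smul a b }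
  have : FiniteDimensional ℝ (Molecules p M) :=
    inferInstanceAs (FiniteDimensional ℝ (LinearMap.range (boundary M)))
  have hcl : IsClosed (LinearMap.range ι : Set (Completion (Molecules p M))) :=
    (LinearMap.range ι).closed_of_finiteDimensional
  have htop : ∀ ξ : Completion (Molecules p M), ξ ∈ LinearMap.range ι := fun ξ =>
    hcl.closure_subset_iff.2 subset_rfl (Completion.denseRange_coe ξ)
  exact FiniteDimensional.of_surjective (V₂ := Completion (Molecules p M)) ι htop

/-! ### Decompositions of free spaces along partitions of unity -/

theorem lipschitzFreeDelta_self {M : Type u} [MetricSpace M] (o : M) :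
    lipschitzFreeDelta p o o = 0 := by
  have h : (molecule p o o : Molecules p M) = 0 := Subtype.ext (sub_self _)
  exact (congrArg _ h).trans Completion.coe_zero

theorem norm_lipschitzFreeSpace_rpow {M : Type u} [MetricSpace M] (ξ : lipschitzFreeSpace p M) :
    ‖ξ‖ ^ (p : ℝ) = norm (E := Completion (Molecules p M)) ξ := by
  change (norm (E := Completion (Molecules p M)) ξ ^ (1 / (p : ℝ))) ^ (p : ℝ) = _
  rw [one_div]
  exact Real.rpow_inv_rpow (norm_nonneg (E := Completion (Molecules p M)) ξ) (p_pos p).ne'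

theorem norm_lipschitzFreeDelta {M : Type u} [MetricSpace M] (o x : M) :
    ‖lipschitzFreeDelta p o x‖ = dist x o := by
  rw [← norm_lipschitzFreeDelta_sub p o x o, lipschitzFreeDelta_self, sub_zero]

/-- The weighted point evaluation `x ↦ a x • δ x` is Lipschitz as soon as the oscillation of the
weight `a` is small compared with the distance to the base point. -/
theorem norm_smul_delta_sub_rpow_le {N : Type u} [MetricSpace N] (o : N) (x y : N) (a c C D : ℝ)
    (hD : dist x y ≤ D) (hc : |c| ≤ 1) (hC : |a - c| * dist x o ≤ C * D) :
    ‖a • lipschitzFreeDelta p o x - c • lipschitzFreeDelta p o y‖ ^ (p : ℝ) ≤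
      (C * D) ^ (p : ℝ) + D ^ (p : ℝ) := by
  have hp := p_pos p
  set X := lipschitzFreeSpace p N
  have e : a • lipschitzFreeDelta p o x - c • lipschitzFreeDelta p o y =
      (a - c) • lipschitzFreeDelta p o x +
        c • (lipschitzFreeDelta p o x - lipschitzFreeDelta p o y) := by
    rw [sub_smul, smul_sub]
    abel
  rw [e]
  refine (X.norm_add_rpow_le _ _).trans (add_le_add ?_ ?_)
  · refine Real.rpow_le_rpow (X.norm_nonneg' _) ?_ hp.le
    rwa [X.norm_smul', norm_lipschitzFreeDelta]
  · refine Real.rpow_le_rpow (X.norm_nonneg' _) ?_ hp.le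
    rw [X.norm_smul', norm_lipschitzFreeDelta_sub]
    exact (mul_le_of_le_one_left dist_nonneg hc).trans hD

/-- The decomposition principle. A partition of unity `φ n`, at most `m` members of which are
nonzero at each point, makes `F_p(N)` complemented in the `ℓ_p`-sum of the free spaces over
the pieces `N' n`, provided that `φ n` is Lipschitz with constant of order `1 / dist x b` at `x`.
The piece `N' n` is embedded in `N` by `j n`, and `r n` is a section of `j n` where `φ n ≠ 0`. The
operator `F_p(N) → ⨁ F_p(N' n)` extends `δ x ↦ (φ n x • δ (r n x))`; its left inverse is the
sum of the operators induced by the `j n`. -/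
theorem of_partition {P : PBanachSpace.{u} p → Prop} (hP : IsStableProperty P)
    {N : Type u} [MetricSpace N] (b : N) {N' : ℕ → Type u} [∀ n, MetricSpace (N' n)]
    (j : ∀ n, N' n → N) (hj : ∀ n, Isometry (j n)) (b' : ∀ n, N' n) (hb : ∀ n, j n (b' n) = b)
    (r : ∀ n, N → N' n) (φ : ℕ → N → ℝ) (hr : ∀ n x, φ n x ≠ 0 → j n (r n x) = x)
    (m : ℕ) (hm : ∀ x, ∃ s : Finset ℕ, s.card ≤ m ∧ ∀ n ∉ s, φ n x = 0)
    (hsum : ∀ x, x ≠ b → HasSum (fun n => φ n x) 1) (hle : ∀ n x, |φ n x| ≤ 1)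
    (C : ℝ) (hC0 : 0 ≤ C)
    (hC : ∀ n x y, φ n x ≠ 0 → |φ n x - φ n y| * dist x b ≤ C * dist x y)
    (hN' : ∀ n, P (lipschitzFreeSpace p (N' n))) : P (lipschitzFreeSpace p N) := by
  have hp := p_pos p
  let X : ℕ → PBanachSpace.{u} p := fun n => lipschitzFreeSpace p (N' n)
  let F : PBanachSpace.{u} p := lipschitzFreeSpace p N
  let δ : N → F := lipschitzFreeDelta p b
  let δ' : ∀ n, N' n → X n := fun n => lipschitzFreeDelta p (b' n)
  have hX0 : ∀ n, ‖(0 : X n)‖ = 0 := fun n => ((X n).norm_eq_zero' 0).2 rfl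
  have hι : ∀ n, ∃ ι : X n →ₗ[ℝ] F, (∀ ξ, ‖ι ξ‖ ≤ 1 * ‖ξ‖) ∧ ∀ x, ι (δ' n x) = δ (j n x) := by
    intro n
    obtain ⟨ι, hι, -⟩ := lipschitzFreeSpace_universal p (b' n) F (fun x => δ (j n x)) 1 zero_le_one
      (fun x y => by rw [norm_lipschitzFreeDelta_sub, (hj n).dist_eq, one_mul])
      (by rw [hb]; exact lipschitzFreeDelta_self b)
    exact ⟨ι, hι⟩
  choose ι hι1 hι2 using hι
  -- the coordinates of the operator into the sum
  let f₀ : N → ∀ n, X n := fun x n => φ n x • δ' n (r n x)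
  have hf₀ : ∀ x n, φ n x = 0 → f₀ x n = 0 := fun x n h => by
    change φ n x • δ' n (r n x) = 0
    rw [h, zero_smul]
  have hzero : ∀ n, ‖(0 : X n)‖ ^ (p : ℝ) = 0 := fun n => by rw [hX0, Real.zero_rpow hp.ne']
  have hmem : ∀ x, f₀ x ∈ lpSubmodule X := fun x => by
    obtain ⟨s, -, hs⟩ := hm x
    exact summable_of_ne_finset_zero (s := s) fun n hn => by rw [hf₀ x n (hs n hn), hzero]
  have hdist : ∀ n x, φ n x ≠ 0 → dist (r n x) (b' n) = dist x b := fun n x h => by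
    rw [← (hj n).dist_eq, hr n x h, hb]
  have hone : ∀ n x y, φ n y = 0 → ‖f₀ x n - f₀ y n‖ ^ (p : ℝ) ≤ (C * dist x y) ^ (p : ℝ) := by
    intro n x y hy
    refine Real.rpow_le_rpow ((X n).norm_nonneg' _) ?_ hp.le
    rw [hf₀ y n hy, sub_zero]
    change ‖φ n x • δ' n (r n x)‖ ≤ _
    by_cases hx : φ n x = 0
    · rw [hx, zero_smul, hX0]
      positivity
    · have h := hC n x y hx
      rwa [hy, sub_zero, ← hdist n x hx, ← norm_lipschitzFreeDelta (p := p), ← (X n).norm_smul']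
        at h
  have hpt : ∀ n x y, ‖f₀ x n - f₀ y n‖ ^ (p : ℝ) ≤
      (C * dist x y) ^ (p : ℝ) + dist x y ^ (p : ℝ) := by
    intro n x y
    have hd : 0 ≤ dist x y ^ (p : ℝ) := by positivity
    by_cases hy : φ n y = 0
    · linarith [hone n x y hy]
    by_cases hx : φ n x = 0
    · have h := hone n y x hx
      rw [(X n).norm_sub_rev', dist_comm] at h
      linarith
    · refine norm_smul_delta_sub_rpow_le _ _ _ _ _ _ _ ?_ (hle n y) ?_
      · rw [← (hj n).dist_eq, hr n x hx, hr n y hy]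
      · rw [hdist n x hx]
        exact hC n x y hx
  let f : N → lpSum X := fun x => (⟨f₀ x, hmem x⟩ : lpSubmodule X)
  -- at most `2 * m` coordinates of `f x - f y` are nonzero, and `hpt` bounds each of them
  let B : ℝ := (2 * m) * (C ^ (p : ℝ) + 1)
  have hB : 0 ≤ B := by positivity
  have hf : ∀ x y, ‖f x - f y‖ ≤ B ^ (1 / (p : ℝ)) * dist x y := by
    intro x y
    change (∑' n, ‖f₀ x n - f₀ y n‖ ^ (p : ℝ)) ^ (1 / (p : ℝ)) ≤ _
    have h1 : ∑' n, ‖f₀ x n - f₀ y n‖ ^ (p : ℝ) ≤ B * dist x y ^ (p : ℝ) := by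
      obtain ⟨s, hs, hs'⟩ := hm x
      obtain ⟨t, ht, ht'⟩ := hm y
      classical
      rw [tsum_eq_sum (s := s ∪ t) fun n hn => by
        rw [Finset.notMem_union] at hn
        rw [hf₀ x n (hs' n hn.1), hf₀ y n (ht' n hn.2), sub_zero, hzero]]
      refine (Finset.sum_le_card_nsmul _ _ _ fun n _ => hpt n x y).trans ?_
      rw [nsmul_eq_mul, Real.mul_rpow hC0 dist_nonneg]
      have h2 : ((s ∪ t).card : ℝ) ≤ 2 * m := by
        have := Finset.card_union_le s t
        exact_mod_cast (by omega : (s ∪ t).card ≤ 2 * m)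
      calc _ ≤ (2 * m : ℝ) * (C ^ (p : ℝ) * dist x y ^ (p : ℝ) + dist x y ^ (p : ℝ)) :=
            mul_le_mul_of_nonneg_right h2 (by positivity)
        _ = _ := by simp only [B]; ring
    refine (Real.rpow_le_rpow (tsum_rpow_nonneg fun n => f₀ x n - f₀ y n) h1
      (by positivity)).trans_eq ?_
    rw [Real.mul_rpow hB (by positivity), one_div, Real.rpow_rpow_inv dist_nonneg hp.ne']
  have hfb : f b = 0 := by
    refine Subtype.ext (funext fun n => ?_)
    change f₀ b n = 0
    by_cases h : φ n b = 0
    · exact hf₀ b n h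
    · have h1 : r n b = b' n := (hj n).injective ((hr n b h).trans (hb n).symm)
      change φ n b • δ' n (r n b) = 0
      rw [h1, show δ' n (b' n) = 0 from lipschitzFreeDelta_self _, smul_zero]
  obtain ⟨T, ⟨hTb, hT⟩, -⟩ := lipschitzFreeSpace_universal p b (lpSum X) f (B ^ (1 / (p : ℝ)))
    (by positivity) hf hfb
  obtain ⟨S, hSb, hS⟩ := exists_lpSum_desc (E := Completion (Molecules p N))
    norm_completion_smul X ι fun n x => by
      have h := Real.rpow_le_rpow (F.norm_nonneg' _) (hι1 n x) hp.le
      rw [one_mul] at h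
      exact (norm_lipschitzFreeSpace_rpow _).symm.trans_le h
  let S' : lpSum X →ₗ[ℝ] F := S
  have hS' : IsBounded S' := ⟨1, fun x => by
    have h := Real.rpow_le_rpow (norm_nonneg _) (hSb x) (one_div_pos.2 hp).le
    rw [one_div, Real.rpow_rpow_inv ((lpSum X).norm_nonneg' _) hp.ne', ← one_div] at h
    rw [one_mul]
    exact h⟩
  have hSf : ∀ x, S' (f x) = δ x := by
    intro x
    refine (hS ⟨f₀ x, hmem x⟩).trans ?_
    by_cases hx : x = b
    · have h0 : ∀ n, ι n (f₀ x n) = 0 := fun n => by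
        have h : f₀ b n = 0 := congrFun (congrArg Subtype.val hfb) n
        rw [hx, h, map_zero]
      refine (tsum_congr (α := Completion (Molecules p N)) h0).trans
        ((tsum_zero (α := Completion (Molecules p N))).trans ?_)
      rw [hx]
      exact (lipschitzFreeDelta_self b).symm
    · have h1 : ∀ n, ι n (f₀ x n) = φ n x • δ x := fun n => by
        change ι n (φ n x • δ' n (r n x)) = _
        rw [map_smul, hι2]
        by_cases h : φ n x = 0
        · rw [h, zero_smul, zero_smul]
        · rw [hr n x h]
      refine (tsum_congr (α := Completion (Molecules p N)) h1).trans ?_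
      let ξ : Completion (Molecules p N) := δ x
      have h2 := (hsum x hx).smul_const ξ
      rw [one_smul] at h2
      exact h2.tsum_eq
  -- `S' ∘ T` and the identity agree on `δ x`, hence everywhere by the universal property
  have hST : S' ∘ₗ T = LinearMap.id := by
    obtain ⟨V, -, hV⟩ := lipschitzFreeSpace_universal p b F δ 1 zero_le_one
      (fun x y => by rw [norm_lipschitzFreeDelta_sub, one_mul]) (lipschitzFreeDelta_self b)
    rw [hV _ (hS'.comp ⟨_, hTb⟩) fun x => by
        change S' (T (lipschitzFreeDelta p b x)) = δ x
        rw [hT, hSf],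
      hV LinearMap.id ⟨1, fun ξ => (one_mul _).ge⟩ fun x => rfl]
  exact hP.of_leftInverse T S' ⟨_, hTb⟩ hS' (fun x => LinearMap.congr_fun hST x)
    (hP.lpSum X hN')

/-- `of_partition` for a subset `A` of a metric space and pieces that are subsets of `A`. -/
theorem of_partition_subset {P : PBanachSpace.{u} p → Prop} (hP : IsStableProperty P)
    {M : Type u} [MetricSpace M] {A : Set M} {b : M} (hbA : b ∈ A) (A' : ℕ → Set M)
    (hbA' : ∀ n, b ∈ A' n) (hsub : ∀ n, A' n ⊆ A) (φ : ℕ → M → ℝ)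
    (hφ : ∀ n, ∀ x ∈ A, φ n x ≠ 0 → x ∈ A' n)
    (m : ℕ) (hm : ∀ x ∈ A, ∃ s : Finset ℕ, s.card ≤ m ∧ ∀ n ∉ s, φ n x = 0)
    (hsum : ∀ x ∈ A, x ≠ b → HasSum (fun n => φ n x) 1) (hle : ∀ n x, |φ n x| ≤ 1)
    (C : ℝ) (hC0 : 0 ≤ C)
    (hC : ∀ n, ∀ x ∈ A, ∀ y ∈ A, φ n x ≠ 0 → |φ n x - φ n y| * dist x b ≤ C * dist x y)
    (hA' : ∀ n, P (lipschitzFreeSpace p (A' n))) : P (lipschitzFreeSpace p A) := by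
  classical
  refine of_partition hP (⟨b, hbA⟩ : A) (fun n => Set.inclusion (hsub n))
    (fun n => Isometry.of_dist_eq fun x y => rfl) (fun n => ⟨b, hbA' n⟩) (fun n => rfl)
    (fun n x => if h : x.1 ∈ A' n then ⟨x.1, h⟩ else ⟨b, hbA' n⟩) (fun n x => φ n x.1)
    (fun n x hx => ?_) m (fun x => hm x.1 x.2) (fun x hx => ?_) (fun n x => hle n x.1) C hC0
    (fun n x y hx => hC n x.1 x.2 y.1 y.2 hx) hA'
  · rw [dif_pos (hφ n x.1 x.2 hx)]
  · exact hsum x.1 x.2 fun h => hx (Subtype.ext h)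

/-! ### Dyadic annuli around a point -/

/-- The piecewise linear tent on `[1 / 2, 2]` with peak `1` at `1`. Its dyadic dilates form a
partition of unity on `(0, ∞)`. -/
noncomputable def tent (s : ℝ) : ℝ := max 0 (min (2 * s - 1) (2 - s))

theorem tent_nonneg (s : ℝ) : 0 ≤ tent s := le_max_left _ _

theorem tent_le_one (s : ℝ) : tent s ≤ 1 := by
  refine max_le zero_le_one ?_
  rcases le_total s 1 with h | h
  · exact (min_le_left _ _).trans (by linarith)
  · exact (min_le_right _ _).trans (by linarith)

theorem tent_eq_zero_of_le {s : ℝ} (h : s ≤ 1 / 2) : tent s = 0 :=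
  max_eq_left ((min_le_left _ _).trans (by linarith))

theorem tent_eq_zero_of_ge {s : ℝ} (h : 2 ≤ s) : tent s = 0 :=
  max_eq_left ((min_le_right _ _).trans (by linarith))

theorem tent_add_tent_half {s : ℝ} (h1 : 1 ≤ s) (h2 : s ≤ 2) : tent s + tent (s / 2) = 1 := by
  unfold tent
  rw [min_eq_right (by linarith : 2 - s ≤ 2 * s - 1), max_eq_right (by linarith),
    min_eq_left (by linarith), max_eq_right (by linarith)]
  ring

theorem abs_tent_sub_le (s t : ℝ) : |tent s - tent t| ≤ 2 * |s - t| := by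
  unfold tent
  refine (abs_max_sub_max_le_max _ _ _ _).trans ?_
  rw [sub_self, abs_zero]
  refine max_le (by positivity) ((abs_min_sub_min_le_max _ _ _ _).trans (max_le ?_ ?_))
  · rw [show 2 * s - 1 - (2 * t - 1) = 2 * (s - t) by ring, abs_mul, abs_two]
  · rw [show 2 - s - (2 - t) = -(s - t) by ring, abs_neg]
    linarith [abs_nonneg (s - t)]

/-- The part of `A` in the closed annulus around `b` with radii `2 ^ (k - 1)` and
`2 ^ (k + 1)`. -/
def dyadicAnnulus {M : Type u} [MetricSpace M] (A : Set M) (b : M) (k : ℤ) : Set M :=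
  {x ∈ A | (2 : ℝ) ^ k / 2 ≤ dist x b ∧ dist x b ≤ 2 ^ k * 2}

/-- The `k`-th tent `tent (dist x b / 2 ^ k)` has Lipschitz constant `2 / 2 ^ k`, while
`dist x b ≤ 2 ^ k * 2` on its support. Hence `F_p(A)` is complemented in the `ℓ_p`-sum of the
free spaces over the dyadic annuli around `b`, each with `b` adjoined. -/
theorem of_dyadicAnnulus {P : PBanachSpace.{u} p → Prop} (hP : IsStableProperty P)
    {M : Type u} [MetricSpace M] {A : Set M} {b : M} (hbA : b ∈ A)
    (h : ∀ k : ℤ, P (lipschitzFreeSpace p ↥(dyadicAnnulus A b k ∪ {b}))) :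
    P (lipschitzFreeSpace p A) := by
  have h2 : ∀ k : ℤ, (0 : ℝ) < 2 ^ k := fun k => by positivity
  let ψ : ℤ → M → ℝ := fun k x => tent (dist x b / 2 ^ k)
  have hψ : ∀ k x, ψ k x ≠ 0 → 2 ^ k / 2 < dist x b ∧ dist x b < 2 ^ k * 2 := by
    intro k x hx
    constructor <;> by_contra! hlt <;> refine hx ?_
    · exact tent_eq_zero_of_le (by rw [div_le_iff₀ (h2 k)]; linarith)
    · exact tent_eq_zero_of_ge (by rw [le_div_iff₀ (h2 k)]; linarith)
  -- for `2 ^ k ≤ dist x b < 2 ^ (k + 1)` only the tents `k` and `k + 1` are nonzero at `x`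
  have hψ0 : ∀ x, x ≠ b → ∀ k ∉ ({Int.log 2 (dist x b), Int.log 2 (dist x b) + 1} : Finset ℤ),
      ψ k x = 0 := by
    intro x hx k hk
    by_contra hne
    obtain ⟨hk1, hk2⟩ := hψ k x hne
    have hd : 0 < dist x b := dist_pos.2 hx
    have h3 := Int.zpow_log_le_self (R := ℝ) one_lt_two hd
    have h4 := Int.lt_zpow_succ_log_self (R := ℝ) one_lt_two (dist x b)
    push_cast at h3 h4
    have h5 : (2 : ℝ) ^ (Int.log 2 (dist x b)) < 2 ^ (k + 1) := by
      rw [zpow_add_one₀ two_ne_zero]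
      exact h3.trans_lt hk2
    have h6 : (2 : ℝ) ^ (k - 1) < 2 ^ (Int.log 2 (dist x b) + 1) := by
      rw [zpow_sub_one₀ two_ne_zero]
      exact lt_trans hk1 h4
    rw [zpow_lt_zpow_iff_right₀ one_lt_two] at h5 h6
    refine hk ?_
    simp only [Finset.mem_insert, Finset.mem_singleton]
    omega
  have hψb : ∀ k, ψ k b = 0 := fun k => tent_eq_zero_of_le (by rw [dist_self, zero_div]; norm_num)
  have hψsum : ∀ x, x ≠ b → HasSum (fun k => ψ k x) 1 := by
    intro x hx
    have hd : 0 < dist x b := dist_pos.2 hx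
    have h3 := Int.zpow_log_le_self (R := ℝ) one_lt_two hd
    have h4 := Int.lt_zpow_succ_log_self (R := ℝ) one_lt_two (dist x b)
    push_cast at h3 h4
    have key : HasSum (fun k => ψ k x) (∑ k ∈ {Int.log 2 (dist x b), Int.log 2 (dist x b) + 1},
        ψ k x) := hasSum_sum_of_ne_finset_zero (hψ0 x hx)
    rw [Finset.sum_pair (by simp)] at key
    convert key using 1
    rw [zpow_add_one₀ two_ne_zero] at h4
    change _ = tent _ + tent _
    rw [zpow_add_one₀ two_ne_zero, ← div_div, tent_add_tent_half]
    · rw [le_div_iff₀ (h2 _)]; linarith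
    · rw [div_le_iff₀ (h2 _)]; linarith
  obtain ⟨e⟩ : Nonempty (ℕ ≃ ℤ) := ⟨Equiv.intEquivNat.symm⟩
  refine of_partition_subset hP hbA (fun n => dyadicAnnulus A b (e n) ∪ {b})
    (fun n => Or.inr rfl) (fun n => ?_) (fun n => ψ (e n)) (fun n x hx hne => ?_) 2
    (fun x _ => ?_) (fun x _ hx => (Equiv.hasSum_iff e).2 (hψsum x hx)) (fun n x => ?_) 4
    (by norm_num) (fun n x _ y _ hne => ?_) (fun n => h (e n))
  · exact Set.union_subset (fun x hx => hx.1) (Set.singleton_subset_iff.2 hbA)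
  · exact Or.inl ⟨hx, (hψ _ _ hne).1.le, (hψ _ _ hne).2.le⟩
  · by_cases hx : x = b
    · exact ⟨∅, by simp, fun n _ => hx ▸ hψb _⟩
    · refine ⟨Finset.map e.symm.toEmbedding {Int.log 2 (dist x b), Int.log 2 (dist x b) + 1},
        (Finset.card_map _).trans_le Finset.card_le_two, fun n hn => hψ0 x hx _ fun hmem => hn ?_⟩
      exact Finset.mem_map.2 ⟨e n, hmem, e.symm_apply_apply n⟩
  · rw [abs_of_nonneg (tent_nonneg _)]
    exact tent_le_one _
  · have h3 := abs_tent_sub_le (dist x b / 2 ^ e n) (dist y b / 2 ^ e n)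
    rw [← sub_div, abs_div, abs_of_pos (h2 _), mul_div_assoc'] at h3
    have h4 : |dist x b - dist y b| ≤ dist x y := abs_dist_sub_le x y b
    calc |ψ (e n) x - ψ (e n) y| * dist x b
        ≤ (2 * |dist x b - dist y b| / 2 ^ e n) * (2 ^ e n * 2) :=
          mul_le_mul h3 (hψ _ _ hne).2.le dist_nonneg (by have := h2 (e n); positivity)
      _ = 4 * |dist x b - dist y b| := by
          have := (h2 (e n)).ne'
          field_simp
          ring
      _ ≤ 4 * dist x y := by linarith

/-! ### Compact sets -/

/-- The property `P` holds near a subset `s` of `M`: for some `ε > 0` the free spaces over all sets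
`K ∪ F` have `P`, where `K` is a compact subset of the `ε`-thickening of `s` and `F` is any finite
set. The finite set absorbs the base points of the decompositions. -/
def HoldsNear (P : PBanachSpace.{u} p → Prop) {M : Type u} [MetricSpace M] (s : Set M) : Prop :=
  ∃ ε : ℝ, 0 < ε ∧ ∀ K : Set M, IsCompact K → K ⊆ Metric.thickening ε s →
    ∀ F : Set M, F.Finite → P (lipschitzFreeSpace p ↥(K ∪ F))

theorem HoldsNear.apply {P : PBanachSpace.{u} p → Prop} {M : Type u} [MetricSpace M] {K : Set M}
    (h : HoldsNear P K) (hK : IsCompact K) {F : Set M} (hF : F.Finite) :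
    P (lipschitzFreeSpace p ↥(K ∪ F)) := by
  obtain ⟨ε, hε, h⟩ := h
  exact h K hK (Metric.self_subset_thickening hε K) F hF

theorem HoldsNear.mono {P : PBanachSpace.{u} p → Prop} {M : Type u} [MetricSpace M] {s t : Set M}
    (hst : s ⊆ t) (h : HoldsNear P t) : HoldsNear P s := by
  obtain ⟨ε, hε, h⟩ := h
  exact ⟨ε, hε, fun K hK hKs => h K hK (hKs.trans (Metric.thickening_subset_of_subset ε hst))⟩

theorem of_finite {P : PBanachSpace.{u} p → Prop} (hP : IsStableProperty P) {M : Type u}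
    [MetricSpace M] {F : Set M} (hF : F.Finite) : P (lipschitzFreeSpace p F) :=
  have : Finite F := hF
  hP.of_finiteDimensional _ (finiteDimensional_lipschitzFreeSpace F)

theorem holdsNear_empty {P : PBanachSpace.{u} p → Prop} (hP : IsStableProperty P) {M : Type u}
    [MetricSpace M] : HoldsNear P (∅ : Set M) := by
  refine ⟨1, one_pos, fun K _ hK F hF => of_finite hP (Set.Finite.union ?_ hF)⟩
  rw [Metric.thickening_empty] at hK
  exact Set.finite_empty.subset hK

/-- A compact set near `s ∪ t` is glued from a part near `s` and a part near `t` along a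
thickened indicator of a neighbourhood of `s`. On bounded sets every Lipschitz function is
admissible in `of_partition`. -/
theorem HoldsNear.union {P : PBanachSpace.{u} p → Prop} (hP : IsStableProperty P) {M : Type u}
    [MetricSpace M] {s t : Set M} (hs : HoldsNear P s) (ht : HoldsNear P t) :
    HoldsNear P (s ∪ t) := by
  obtain ⟨ε₁, hε₁, hs⟩ := hs
  obtain ⟨ε₂, hε₂, ht⟩ := ht
  obtain ⟨ε, hε, h1, h2⟩ : ∃ ε : ℝ, 0 < ε ∧ ε + ε < ε₁ ∧ ε ≤ ε₂ := by
    have h1 := min_le_left ε₁ ε₂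
    have h2 := min_le_right ε₁ ε₂
    have h3 : 0 < min ε₁ ε₂ := lt_min hε₁ hε₂
    exact ⟨min ε₁ ε₂ / 3, by linarith, by linarith, by linarith⟩
  refine ⟨ε, hε, fun K hK hKst F hF => ?_⟩
  rcases (K ∪ F).eq_empty_or_nonempty with h0 | ⟨b, hb⟩
  · rw [h0]
    exact of_finite hP Set.finite_empty
  set E := Metric.thickening ε s
  let g : M → ℝ := fun x => (thickenedIndicator hε E x : ℝ)
  have hg0 : ∀ x, 0 ≤ g x := fun x => NNReal.coe_nonneg _
  have hg1 : ∀ x, g x ≤ 1 := fun x => by exact_mod_cast thickenedIndicator_le_one hε E x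
  let φ : ℕ → M → ℝ := fun n x => if n = 0 then g x else if n = 1 then 1 - g x else 0
  have hφ0 : ∀ x, φ 0 x = g x := fun x => rfl
  have hφ1 : ∀ x, φ 1 x = 1 - g x := fun x => rfl
  have hφ2 : ∀ n x, φ (n + 2) x = 0 := fun n x => rfl
  have hKF : Bornology.IsBounded (K ∪ F) := (hK.union hF.isCompact).isBounded
  obtain ⟨R, hR⟩ := Metric.isBounded_iff.1 hKF
  have hR0 : 0 ≤ R := dist_nonneg.trans (hR hb hb)
  have hgL : ∀ x y, |g x - g y| ≤ ε⁻¹ * dist x y := fun x y => by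
    have h := (lipschitzWith_thickenedIndicator hε E).dist_le_mul x y
    rwa [NNReal.dist_eq, NNReal.coe_inv, Real.coe_toNNReal _ hε.le] at h
  have hφL : ∀ n x y, |φ n x - φ n y| ≤ ε⁻¹ * dist x y := by
    intro n x y
    match n with
    | 0 => exact hgL x y
    | 1 =>
      rw [hφ1, hφ1, sub_sub_sub_cancel_left, abs_sub_comm]
      exact hgL x y
    | n + 2 =>
      rw [hφ2, hφ2, sub_self, abs_zero]
      positivity
  let A' : ℕ → Set M := fun n => if n = 0 then K ∩ Metric.cthickening ε E else K \ E
  have hA'K : ∀ n, A' n ⊆ K := by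
    intro n
    dsimp only [A']
    split_ifs
    · exact Set.inter_subset_left
    · exact Set.sdiff_subset
  have hFb : (F ∪ {b}).Finite := hF.union (Set.finite_singleton b)
  refine of_partition_subset hP hb (fun n => A' n ∪ (F ∪ {b})) (fun n => Or.inr (Or.inr rfl))
    (fun n => ?_) φ (fun n x hx hne => ?_) 2 (fun x _ => ⟨{0, 1}, Finset.card_le_two, ?_⟩)
    (fun x _ _ => ?_) (fun n x => ?_) (ε⁻¹ * R) (by positivity) (fun n x hx y hy _ => ?_)
    (fun n => ?_)
  · exact Set.union_subset ((hA'K n).trans Set.subset_union_left)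
      (Set.union_subset Set.subset_union_right (Set.singleton_subset_iff.2 hb))
  · rcases hx with hx | hx
    · refine Or.inl ?_
      match n with
      | 0 =>
        refine ⟨hx, Metric.thickening_subset_cthickening _ _ ?_⟩
        by_contra hout
        exact hne (by rw [hφ0]; simp only [g, thickenedIndicator_zero hε E hout, NNReal.coe_zero])
      | 1 =>
        refine ⟨hx, fun hin => hne ?_⟩
        rw [hφ1]
        simp only [g, thickenedIndicator_one hε E hin, NNReal.coe_one, sub_self]
      | n + 2 => exact absurd (hφ2 n x) hne
    · exact Or.inr (Or.inl hx)
  · intro n hn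
    match n with
    | 0 => simp at hn
    | 1 => simp at hn
    | n + 2 => exact hφ2 n x
  · have key : HasSum (fun n => φ n x) (∑ n ∈ ({0, 1} : Finset ℕ), φ n x) := by
      refine hasSum_sum_of_ne_finset_zero fun n hn => ?_
      match n with
      | 0 => simp at hn
      | 1 => simp at hn
      | n + 2 => exact hφ2 n x
    rwa [Finset.sum_pair zero_ne_one, hφ0, hφ1, add_sub_cancel] at key
  · have h3 := hg0 x
    have h4 := hg1 x
    match n with
    | 0 => rw [hφ0, abs_of_nonneg h3]; exact h4
    | 1 => rw [hφ1, abs_of_nonneg (by linarith)]; linarith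
    | n + 2 => rw [hφ2, abs_zero]; exact zero_le_one
  · rw [mul_right_comm]
    exact mul_le_mul (hφL n x y) (hR hx hb) dist_nonneg (by positivity)
  -- the first piece lies in a thickening of `s`, the second one misses `E` and so lies near `t`
  · match n with
    | 0 =>
      refine hs _ (hK.inter_right Metric.isClosed_cthickening) (fun x hx => ?_) _ hFb
      exact Metric.cthickening_subset_thickening' hε₁ h1 s
        (Metric.cthickening_thickening_subset hε.le ε s hx.2)
    | n + 1 =>
      refine ht _ (hK.diff Metric.isOpen_thickening) (fun x hx => ?_) _ hFb
      have h3 := hKst hx.1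
      rw [Metric.thickening_union] at h3
      exact Metric.thickening_mono h2 t (h3.resolve_left hx.2)

theorem HoldsNear.exists_ball {P : PBanachSpace.{u} p → Prop} {M : Type u} [MetricSpace M] {x : M}
    (h : HoldsNear P {x}) : ∃ r : ℝ, 0 < r ∧ HoldsNear P (Metric.ball x r) := by
  obtain ⟨ε, hε, h⟩ := h
  refine ⟨ε / 2, half_pos hε, ε / 2, half_pos hε, fun K hK hKs => h K hK (hKs.trans ?_)⟩
  rw [← Metric.thickening_singleton]
  exact (Metric.thickening_thickening_subset _ _ _).trans_eq (by rw [add_halves])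

theorem isOpen_setOf_holdsNear (P : PBanachSpace.{u} p → Prop) (M : Type u) [MetricSpace M] :
    IsOpen {x : M | HoldsNear P {x}} := by
  refine Metric.isOpen_iff.2 fun x hx => ?_
  obtain ⟨r, hr, h⟩ := HoldsNear.exists_ball hx
  exact ⟨r, hr, fun y hy => h.mono (Set.singleton_subset_iff.2 hy)⟩

theorem holdsNear_of_isCompact {P : PBanachSpace.{u} p → Prop} (hP : IsStableProperty P)
    {M : Type u} [MetricSpace M] {K : Set M} (hK : IsCompact K)
    (h : ∀ x ∈ K, HoldsNear P {x}) : HoldsNear P K := by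
  refine hK.induction_on (holdsNear_empty hP) (fun s t hst ht => ht.mono hst)
    (fun s t hs ht => hs.union hP ht) fun x hx => ?_
  obtain ⟨r, hr, hr'⟩ := (h x hx).exists_ball
  exact ⟨_, mem_nhdsWithin_of_mem_nhds (Metric.ball_mem_nhds x hr), hr'⟩

/-! ### Scattered spaces -/

theorem isClosed_dyadicAnnulus_univ {M : Type u} [MetricSpace M] (b : M) (k : ℤ) :
    IsClosed (dyadicAnnulus Set.univ b k) := by
  have h : dyadicAnnulus Set.univ b k =
      (fun x => dist x b) ⁻¹' Set.Icc (2 ^ k / 2) (2 ^ k * 2) := by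
    ext x
    simp [dyadicAnnulus]
  rw [h]
  exact isClosed_Icc.preimage (continuous_id.dist continuous_const)

/-- If `P` holds near every point of a punctured ball around `x`, it holds near `x`: the dyadic
annuli around `x` stay away from `x`. -/
theorem holdsNear_singleton_of_punctured {P : PBanachSpace.{u} p → Prop}
    (hP : IsStableProperty P) {M : Type u} [MetricSpace M] {x : M} {r : ℝ} (hr : 0 < r)
    (h : ∀ y ∈ Metric.ball x r, y ≠ x → HoldsNear P {y}) : HoldsNear P {x} := by
  refine ⟨r, hr, fun K hK hKx F hF => ?_⟩
  rw [Metric.thickening_singleton] at hKx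
  by_cases hx : x ∈ K
  · refine of_dyadicAnnulus hP (b := x) (Or.inl hx) fun k => ?_
    have hcpt : IsCompact (K ∩ dyadicAnnulus Set.univ x k) :=
      hK.inter_right (isClosed_dyadicAnnulus_univ x k)
    have hfin : (F ∩ dyadicAnnulus Set.univ x k ∪ {x}).Finite :=
      (hF.inter_of_left _).union (Set.finite_singleton x)
    have e : dyadicAnnulus (K ∪ F) x k ∪ {x} =
        (K ∩ dyadicAnnulus Set.univ x k) ∪ (F ∩ dyadicAnnulus Set.univ x k ∪ {x}) := by
      ext y
      simp only [dyadicAnnulus, Set.mem_union, Set.mem_inter_iff, Set.mem_ofPred_eq, Set.mem_univ,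
        true_and]
      tauto
    rw [e]
    refine (holdsNear_of_isCompact hP hcpt fun y hy => h y (hKx hy.1) ?_).apply hcpt hfin
    rintro rfl
    have h1 := hy.2.2.1
    rw [dist_self] at h1
    have h2 : (0 : ℝ) < 2 ^ k := by positivity
    linarith
  · exact (holdsNear_of_isCompact hP hK fun y hy =>
      h y (hKx hy) fun hyx => hx (hyx ▸ hy)).apply hK hF

/-- A nonempty closed subset of a scattered space has a relatively isolated point, since otherwise
it would be perfect and survive in all Cantor-Bendixson derivatives. -/
theorem exists_isolated_of_isScattered {M : Type u} [MetricSpace M] (hM : IsScattered M)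
    {C : Set M} (hC : IsClosed C) (hne : C.Nonempty) :
    ∃ x ∈ C, ∃ r : ℝ, 0 < r ∧ ∀ y ∈ Metric.ball x r, y ≠ x → y ∉ C := by
  by_contra! hcon
  have hperf : Perfect C := by
    refine ⟨hC, fun x hx => ?_⟩
    rw [accPt_iff_nhds]
    intro U hU
    obtain ⟨r, hr, hrU⟩ := Metric.mem_nhds_iff.1 hU
    obtain ⟨y, hy, hyx, hyC⟩ := hcon x hx r hr
    exact ⟨y, ⟨hrU hy, hyC⟩, hyx⟩
  obtain ⟨α, hα⟩ := hM
  obtain ⟨x, hx⟩ := hne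
  have h := (hperf.subset_perfectKernel (Set.subset_univ C)).trans
    (CantorBendixson.perfectKernel_subset_iteratedDerivedSet Set.univ α) hx
  rw [hα] at h
  exact h

theorem holdsNear_of_isScattered {P : PBanachSpace.{u} p → Prop} (hP : IsStableProperty P)
    {M : Type u} [MetricSpace M] (hM : IsScattered M) (x : M) : HoldsNear P {x} := by
  by_contra hx
  obtain ⟨y, hy, r, hr, h⟩ := exists_isolated_of_isScattered hM
    (isOpen_setOf_holdsNear P M).isClosed_compl ⟨x, hx⟩
  exact hy (holdsNear_singleton_of_punctured hP hr fun z hz hzy => not_not.1 (h z hz hzy))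

theorem of_univ {P : PBanachSpace.{u} p → Prop} (hP : IsStableProperty P) {M : Type u}
    [MetricSpace M] (b : M) (h : P (lipschitzFreeSpace p (Set.univ : Set M))) :
    P (lipschitzFreeSpace p M) := by
  refine of_partition hP b (N' := fun _ => (Set.univ : Set M)) (fun _ => Subtype.val)
    (fun _ => isometry_subtype_coe) (fun _ => ⟨b, trivial⟩) (fun _ => rfl)
    (fun _ x => ⟨x, trivial⟩) (fun n _ => if n = 0 then 1 else 0) (fun _ _ _ => rfl) 1
    (fun _ => ⟨{0}, le_rfl, fun n hn => if_neg (by simpa using hn)⟩)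
    (fun _ _ => hasSum_ite_eq 0 1) (fun n _ => ?_) 0 le_rfl (fun n x y _ => by simp) (fun _ => h)
  split_ifs <;> simp

end LipschitzFree

open LipschitzFree in
theorem mainTheorem8 (p : Set.Ioc (0 : ℝ) 1) (P : PBanachSpace.{u} p → Prop)
    (hfin : ∀ X : PBanachSpace.{u} p, FiniteDimensional ℝ X → P X)
    (hsum : ∀ X : ℕ → PBanachSpace.{u} p, (∀ n, P (X n)) → P (PBanachSpace.lpSum X))
    (hiso : ∀ X Y : PBanachSpace.{u} p, PBanachSpace.Isomorphic X Y → P X → P Y)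
    (hcompl : ∀ (X : PBanachSpace.{u} p) (S : Submodule ℝ X) (hS : X.IsClosedSubspace S),
      X.IsComplemented S → P X → P (X.subspace S hS))
    (M : Type u) [MetricSpace M] [ProperSpace M] (hM : IsScattered M) :
    P (lipschitzFreeSpace p M) := by
  have hP : PBanachSpace.IsStableProperty P := ⟨hfin, hsum, hiso, hcompl⟩
  rcases isEmpty_or_nonempty M with h | ⟨⟨b⟩⟩
  · exact hfin _ (finiteDimensional_lipschitzFreeSpace M)
  refine of_univ hP b (of_dyadicAnnulus hP (Set.mem_univ b) fun k => ?_)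
  have hcpt : IsCompact (dyadicAnnulus Set.univ b k) :=
    (isCompact_closedBall b (2 ^ k * 2)).of_isClosed_subset (isClosed_dyadicAnnulus_univ b k)
      fun x hx => hx.2.2
  exact (holdsNear_of_isCompact hP hcpt fun x _ => holdsNear_of_isScattered hP hM x).apply hcpt
    (Set.finite_singleton b)
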